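/- Let $m\ge 6$ be even, let $F$ be a field with $2^{m-1}$ elements, let $\sigma=2^s$ with $\gcd(s,m-1)=1$ (for instance $s=1$), and identify the coordinate set $\mathbb F_2^m$ with $F\times\mathbb F_2$ by an $\mathbb F_2$-linear isomorphism. The Preparata code $P(m)\subset\mathbb F_2^{2^m}$ consists of the words given by pairs $(X,Y)$ of subsets of $F$ (the parts of the support in $F\times\{0\}$ and $F\times\{1\}$) such that $|X|$ and $|Y|$ are even, $\sum_{x\in X}x=\sum_{y\in Y}y$, and $\sum_{x\in X}x^{\sigma+1}+\bigl(\sum_{x\in X}x\bigr)^{\sigma+1}=\sum_{y\in Y}y^{\sigma+1}$. Let $R=\mathrm{RM}(m-3,m)$ be the Reed–Muller code of the value vectors on $\mathbb F_2^m$ of polynomials of degree at most $m-3$. For $a,b\in\mathbb F_2^{2^m}$ write $X^aZ^b=\bigotimes_i\sigma_x^{a_i}\sigma_z^{b_i}$ on $(\mathbb C^2)^{\otimes 2^m}$; its weight is the number of $i$ with $(a_i,b_i)\neq(0,0)$. A code (subspace) $Q$ of dimension greater than one has minimum distance $d$ if $d$ is the least weight of an operator $E=X^aZ^b$ for which there is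 no $c\in\mathbb C$ with $\langle\varphi|E|\psi\rangle=c\langle\varphi|\psi\rangle$ for all $\varphi,\psi\in Q$; an $((n,K,d))$ code is a $K$-dimensional subspace of $(\mathbb C^2)^{\otimes n}$ with minimum distance $d$. A stabilizer code is a nonzero joint $+1$ eigenspace of a set of commuting operators of the form $i^kX^aZ^b$. Then: 1. $P(m)$ is a disjoint union of cosets of $R$, and the number of these cosets is $K_P=2^{\binom m2-m+1}$. 2. $R^\perp\subseteq R$. Let $\mathcal C_0$ be the CSS code of $R$, i.e. the joint $+1$ eigenspace of all $X^a$ and $Z^b$ with $a,b\in R^\perp$. For all sets $T_1,T_2$ of representatives of the cosets of $R$ in $P(m)$, the CSS-like union code $Q=\bigoplus_{t_1\in T_1,\,t_2\in T_2}X^{t_1}Z^{t_2}\mathcal C_0$ has dimension $K_P^2\dim\mathcal C_0$, is a $((2^m,2^{2^m-4m},6))$ quantum code, and is non-additive, i.e. not a stabilizer code. In particular one obtains $((64,2^{40},6))$ for $m=6$ and $((256,2^{224},6))$ for $m=8$. 3. The dimension of $Q$ exceeds that of the enlarged Reed–Muller stabilizer codes: for every linear complement $D$ of $R$ in $\mathrm{RM}(m-2,m)$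 and every invertible linear map $A:D\to D$ without nonzero fixed points, the code $Q_1=\bigoplus_{v\in D}X^vZ^{Av}\mathcal C_0$ is a stabilizer code of dimension $2^{2^m-\binom m2-2m-2}$ that detects all $X^aZ^b$ of weight less than $6$ (so its minimum distance is at least $6$), and $\dim Q_1<\dim Q$. -/

import Mathlib

open scoped Matrix

namespace UnionCode

noncomputable section

/-! ### Classical binary codes -/

/-- The dual of a linear binary code with respect to the standard dot product. -/
def dualCode {ι : Type*} [Fintype ι] (C : Submodule (ZMod 2) (ι → ZMod 2)) :
    Submodule (ZMod 2) (ι → ZMod 2) where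
  carrier := {v | ∀ c ∈ C, v ⬝ᵥ c = 0}
  add_mem' := by
    intro v w hv hw c hc
    rw [add_dotProduct, hv c hc, hw c hc, add_zero]
  zero_mem' := by
    intro c _
    exact zero_dotProduct c
  smul_mem' := by
    intro r v hv c hc
    rw [smul_dotProduct, hv c hc, smul_zero]

/-- The binary Reed-Muller code `RM(r, m)`: the value vectors on `𝔽₂^m` of the polynomials in `m`
variables of total degree at most `r`. The `2^m` coordinates are indexed by the points of `𝔽₂^m`. -/
def reedMuller (r m : ℕ) : Submodule (ZMod 2) ((Fin m → ZMod 2) → ZMod 2) :=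
  (MvPolynomial.restrictTotalDegree (Fin m) (ZMod 2) r).map (MvPolynomial.evalₗ (ZMod 2) (Fin m))

/-- The (extended) Preparata code on the coordinate set `F × 𝔽₂`, with `σ = 2 ^ s`. A word `c` is the
pair `(X, Y)` of subsets of `F` with indicators `c (·, 0)` and `c (·, 1)`; it is a codeword iff
`|X|` and `|Y|` are even, `∑_X x = ∑_Y y`, and `∑_X x^(σ+1) + (∑_X x)^(σ+1) = ∑_Y y^(σ+1)`.
Preparata's original code is the case `s = 1`. -/
def preparataOn (F : Type*) [Field F] [Fintype F] [Algebra (ZMod 2) F] (s : ℕ) :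
    Set (F × ZMod 2 → ZMod 2) :=
  {c | ∑ x, c (x, 0) = 0 ∧ ∑ y, c (y, 1) = 0 ∧
    ∑ x, c (x, 0) • x = ∑ y, c (y, 1) • y ∧
    ∑ x, c (x, 0) • x ^ (2 ^ s + 1) + (∑ x, c (x, 0) • x) ^ (2 ^ s + 1) =
      ∑ y, c (y, 1) • y ^ (2 ^ s + 1)}

/-- The Preparata code `P(m)` with its coordinates indexed by the points of `𝔽₂^m`, through a linear
identification of `𝔽₂^m` with `F × 𝔽₂`. -/
def preparata {m : ℕ} {F : Type*} [Field F] [Fintype F] [Algebra (ZMod 2) F]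
    (e : (Fin m → ZMod 2) ≃ₗ[ZMod 2] F × ZMod 2) (s : ℕ) : Set ((Fin m → ZMod 2) → ZMod 2) :=
  {c | (fun p => c (e.symm p)) ∈ preparataOn F s}

/-- `S` is the disjoint union of the cosets `t + C`, `t ∈ T`, these cosets being distinct. -/
def IsCosetDecomposition {ι : Type*} (C : Submodule (ZMod 2) (ι → ZMod 2))
    (T : Finset (ι → ZMod 2)) (S : Set (ι → ZMod 2)) : Prop :=
  (∀ v, v ∈ S ↔ ∃ t ∈ T, v - t ∈ C) ∧ ∀ t ∈ T, ∀ t' ∈ T, t - t' ∈ C → t = t'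

/-! ### Quantum codes -/

/-- The Hilbert space `(ℂ²)^{⊗ι}`, with computational basis indexed by the bit strings `ι → 𝔽₂`. -/
abbrev Qubits (ι : Type*) [Fintype ι] : Type _ := EuclideanSpace ℂ (ι → ZMod 2)

/-- The Pauli operator `⊗ᵢ σ_x^{aᵢ} σ_z^{bᵢ}`, which maps `|y⟩` to `(-1)^{b·y} |y + a⟩`. -/
def pauliOp {ι : Type*} [Fintype ι] [DecidableEq ι] (a b : ι → ZMod 2) :
    Qubits ι →ₗ[ℂ] Qubits ι where
  toFun ψ := WithLp.toLp 2 fun x => (-1 : ℂ) ^ (b ⬝ᵥ (x + a)).val * ψ (x + a)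
  map_add' := by
    intro φ ψ
    ext x
    simp [mul_add]
  map_smul' := by
    intro r ψ
    ext x
    simp [mul_left_comm]

/-- The weight of `⊗ᵢ σ_x^{aᵢ} σ_z^{bᵢ}`: the number of tensor factors different from identity. -/
def pauliWeight {ι : Type*} [Fintype ι] (a b : ι → ZMod 2) : ℕ :=
  hammingNorm fun i => (a i, b i)

/-- Membership in the Pauli group: a Pauli operator up to a phase `±1, ±i`. -/
def IsPauli {ι : Type*} [Fintype ι] [DecidableEq ι] (g : Qubits ι →ₗ[ℂ] Qubits ι) : Prop :=
  ∃ (k : ℕ) (a b : ι → ZMod 2), g = Complex.I ^ k • pauliOp a b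

/-- Stabilizer (additive) codes: the nonzero joint `+1` eigenspaces of commuting sets of elements of
the Pauli group. -/
def IsStabilizerCode {ι : Type*} [Fintype ι] [DecidableEq ι] (Q : Submodule ℂ (Qubits ι)) : Prop :=
  Q ≠ ⊥ ∧ ∃ S : Set (Qubits ι →ₗ[ℂ] Qubits ι), (∀ g ∈ S, IsPauli g) ∧
    (∀ g ∈ S, ∀ h ∈ S, Commute g h) ∧ ∀ ψ, ψ ∈ Q ↔ ∀ g ∈ S, g ψ = ψ

/-- The code `Q` detects the error `E`: the compression of `E` to `Q` is a scalar. -/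
def Detects {ι : Type*} [Fintype ι] [DecidableEq ι] (Q : Submodule ℂ (Qubits ι))
    (E : Qubits ι →ₗ[ℂ] Qubits ι) : Prop :=
  ∃ c : ℂ, ∀ φ ∈ Q, ∀ ψ ∈ Q, inner ℂ φ (E ψ) = c * inner ℂ φ ψ

/-- The weights of the Pauli errors that `Q` does not detect; for a code of dimension greater
than one, the least of them is its minimum distance. -/
def undetectedWeights {ι : Type*} [Fintype ι] [DecidableEq ι] (Q : Submodule ℂ (Qubits ι)) :
    Set ℕ :=
  {w | ∃ a b : ι → ZMod 2, pauliWeight a b = w ∧ ¬ Detects Q (pauliOp a b)}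

/-- `Q` is an `((n, K, d))` quantum code: `n` qubits, dimension `K`, minimum distance exactly `d`. -/
def IsQuantumCode {ι : Type*} [Fintype ι] [DecidableEq ι] (Q : Submodule ℂ (Qubits ι))
    (n K d : ℕ) : Prop :=
  Fintype.card ι = n ∧ Module.finrank ℂ Q = K ∧ IsLeast (undetectedWeights Q) d

/-- The CSS code of `C₁` and `C₂` (where `C₂^⊥ ⊆ C₁`): the joint `+1` eigenspace of the operators
`X^a`, `a ∈ C₂^⊥`, and `Z^b`, `b ∈ C₁^⊥`. -/
def cssCode {ι : Type*} [Fintype ι] [DecidableEq ι] (C₁ C₂ : Submodule (ZMod 2) (ι → ZMod 2)) :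
    Submodule ℂ (Qubits ι) where
  carrier := {ψ | (∀ a ∈ dualCode C₂, pauliOp a 0 ψ = ψ) ∧ ∀ b ∈ dualCode C₁, pauliOp 0 b ψ = ψ}
  add_mem' := by
    intro φ ψ hφ hψ
    refine ⟨fun a ha => ?_, fun b hb => ?_⟩
    · rw [map_add, hφ.1 a ha, hψ.1 a ha]
    · rw [map_add, hφ.2 b hb, hψ.2 b hb]
  zero_mem' := ⟨fun a _ => map_zero _, fun b _ => map_zero _⟩
  smul_mem' := by
    intro r ψ hψ
    refine ⟨fun a ha => ?_, fun b hb => ?_⟩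
    · rw [map_smul, hψ.1 a ha]
    · rw [map_smul, hψ.2 b hb]

/-- The union code: the span of the translates `X^{t₁} Z^{t₂} C₀`, `(t₁ | t₂) ∈ T`. -/
def unionCode {ι : Type*} [Fintype ι] [DecidableEq ι] (C₀ : Submodule ℂ (Qubits ι))
    (T : Set ((ι → ZMod 2) × (ι → ZMod 2))) : Submodule ℂ (Qubits ι) :=
  ⨆ t ∈ T, C₀.map (pauliOp t.1 t.2)

/-- The CSS-like union code from the CSS code of `C₁, C₂` and the translations
`(t₁ | t₂)`, `t₁ ∈ T₁`, `t₂ ∈ T₂`. -/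
def cssUnionCode {ι : Type*} [Fintype ι] [DecidableEq ι]
    (C₁ C₂ : Submodule (ZMod 2) (ι → ZMod 2)) (T₁ T₂ : Finset (ι → ZMod 2)) :
    Submodule ℂ (Qubits ι) :=
  unionCode (cssCode C₁ C₂) {t | t.1 ∈ T₁ ∧ t.2 ∈ T₂}

/-- `D` is a linear complement of `C` in `C'`, and `A` has no nonzero fixed point: the data of an
enlargement of the CSS code of `C` by `C'`. -/
def IsEnlargementData {ι : Type*} (C C' D : Submodule (ZMod 2) (ι → ZMod 2))
    (A : D ≃ₗ[ZMod 2] D) : Prop :=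
  C ⊓ D = ⊥ ∧ C ⊔ D = C' ∧ ∀ v : D, A v = v → v = 0

/-- The enlarged CSS code: the union code from the CSS code of `C` (twice) and the translations
`(v | A v)`, `v ∈ D`. -/
def enlargedCode {ι : Type*} [Fintype ι] [DecidableEq ι]
    (C D : Submodule (ZMod 2) (ι → ZMod 2)) (A : D ≃ₗ[ZMod 2] D) : Submodule ℂ (Qubits ι) :=
  unionCode (cssCode C C) {t | ∃ v : D, t = ((v : ι → ZMod 2), (A v : ι → ZMod 2))}

end

end UnionCode

open UnionCode

namespace UnionCode

/-! ### Duals of binary codes -/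

section Dual

variable {ι : Type*} [Fintype ι]

/-! Put R = RM(m-3,m). The spaces `translate R t` are the joint eigenspaces of all X^a, Z^b with a,
b in R^⊥. They depend only on t modulo R × R, are orthogonal for different classes, have equal
dimension and together span everything, and X^aZ^b carries the one at t to the one at t + (a,b).
Hence a union code is governed by its index set modulo R × R: the dimension is a count of classes,
an error is detected if it joins no two indices (`detects_of_forall_notMem`) and undetected if it
joins two different classes (`not_detects_of_mem`), and a stabilizer code with 0 among its classes
has an index set closed under addition (`exists_add_sub_mem_of_isStabilizerCode`).

For Q the index set is P × P. So Q inherits distance 6 from P, attained by a word of weight 6, which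
lies outside R because R has minimum weight 8; and Q is non-additive because P is.

The facts on P come from the quadratic map x^(σ+1), with polar form x^σ y + x y^σ. All defining sums
of P involve functions of degree at most 2, to which R is orthogonal; hence `add_mem_preparata`.
Given the first half, the second has a prescribed `syndrome`, and surjectivity of the syndrome
counts P. Distances reduce to weights by `IsPreparataPair.add_translate`, and weights 2 and 4 are
excluded by hand.

For the enlarged code, an undetected error gives a, b, a + b of weight at least 4 each, hence Pauli
weight at least 6. -/

lemma mem_dualCode {C : Submodule (ZMod 2) (ι → ZMod 2)} {v : ι → ZMod 2} :
    v ∈ dualCode C ↔ ∀ c ∈ C, v ⬝ᵥ c = 0 := Iff.rfl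

/-- This is C^⊥⊥ = C in separating form; it supplies the stabilizer element that tells two
translates apart. -/
lemma exists_mem_dualCode_dotProduct_ne_zero {C : Submodule (ZMod 2) (ι → ZMod 2)}
    {v : ι → ZMod 2} (hv : v ∉ C) : ∃ b ∈ dualCode C, b ⬝ᵥ v ≠ 0 := by
  classical
  obtain ⟨f, hfv, hf⟩ := Submodule.exists_le_ker_of_notMem hv
  obtain ⟨b, rfl⟩ := (dotProductEquiv (ZMod 2) ι).surjective f
  exact ⟨b, fun c hc => hf hc, hfv⟩

lemma finrank_add_finrank_dualCode (C : Submodule (ZMod 2) (ι → ZMod 2)) :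
    Module.finrank (ZMod 2) C + Module.finrank (ZMod 2) (dualCode C) = Fintype.card ι := by
  classical
  have h := Subspace.finrank_add_finrank_dualAnnihilator_eq (K := ZMod 2) C
  have h2 : dualCode C = (C.dualAnnihilator).comap
      (dotProductEquiv (ZMod 2) ι : (ι → ZMod 2) →ₗ[ZMod 2] _) := by
    ext v
    simp only [Submodule.mem_comap, Submodule.mem_dualAnnihilator, mem_dualCode]
    rfl
  have h3 : Module.finrank (ZMod 2) (dualCode C) =
      Module.finrank (ZMod 2) C.dualAnnihilator := by
    rw [h2, Submodule.comap_equiv_eq_map_symm]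
    exact LinearEquiv.finrank_map_eq _ _
  rw [h3, h, Module.finrank_fintype_fun_eq_card]

lemma card_submodule_eq (C : Submodule (ZMod 2) (ι → ZMod 2)) :
    Nat.card C = 2 ^ Module.finrank (ZMod 2) C := by
  classical
  rw [Module.natCard_eq_pow_finrank (K := ZMod 2), Nat.card_zmod]

end Dual

/-! ### Reed-Muller codes -/

section ReedMuller

variable {m : ℕ}

/-- The square-free monomial function `x ↦ ∏_{i ∈ S} xᵢ`. -/
def monomialFun (S : Finset (Fin m)) : (Fin m → ZMod 2) → ZMod 2 := fun x => ∏ i ∈ S, x i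

lemma zmod_two_pow_eq_self (x : ZMod 2) {k : ℕ} (hk : k ≠ 0) : x ^ k = x := by
  fin_cases x
  · exact zero_pow hk
  · exact one_pow k

lemma evalₗ_eq_sum_monomialFun (p : MvPolynomial (Fin m) (ZMod 2)) :
    MvPolynomial.evalₗ (ZMod 2) (Fin m) p =
      ∑ d ∈ p.support, p.coeff d • monomialFun d.support := by
  ext x
  rw [MvPolynomial.evalₗ_apply, MvPolynomial.eval_eq]
  simp only [Finset.sum_apply, Pi.smul_apply, smul_eq_mul, monomialFun]
  refine Finset.sum_congr rfl fun d _ => ?_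
  congr 1
  exact Finset.prod_congr rfl fun i hi => zmod_two_pow_eq_self _ (Finsupp.mem_support_iff.1 hi)

lemma evalₗ_prod_X (S : Finset (Fin m)) :
    MvPolynomial.evalₗ (ZMod 2) (Fin m) (∏ i ∈ S, MvPolynomial.X i) = monomialFun S := by
  ext x
  simp [MvPolynomial.evalₗ_apply, monomialFun]

lemma card_support_le_totalDegree {p : MvPolynomial (Fin m) (ZMod 2)} {d : Fin m →₀ ℕ}
    (hd : d ∈ p.support) : d.support.card ≤ p.totalDegree := by
  refine le_trans ?_ (MvPolynomial.le_totalDegree hd)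
  rw [Finset.card_eq_sum_ones]
  exact Finset.sum_le_sum fun i hi => Nat.one_le_iff_ne_zero.2 (Finsupp.mem_support_iff.1 hi)

lemma reedMuller_eq_span (r m : ℕ) :
    reedMuller r m =
      Submodule.span (ZMod 2)
        (Set.range fun S : {S : Finset (Fin m) // S.card ≤ r} => monomialFun S.1) := by
  apply le_antisymm
  · rintro _ ⟨p, hp, rfl⟩
    rw [SetLike.mem_coe, MvPolynomial.mem_restrictTotalDegree] at hp
    rw [evalₗ_eq_sum_monomialFun]
    refine Submodule.sum_mem _ fun d hd => Submodule.smul_mem _ _ (Submodule.subset_span ?_)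
    exact ⟨⟨d.support, (card_support_le_totalDegree hd).trans hp⟩, rfl⟩
  · rw [Submodule.span_le]
    rintro _ ⟨⟨S, hS⟩, rfl⟩
    refine ⟨∏ i ∈ S, MvPolynomial.X i, ?_, evalₗ_prod_X S⟩
    rw [SetLike.mem_coe, MvPolynomial.mem_restrictTotalDegree]
    refine (MvPolynomial.totalDegree_finsetProd _ _).trans ?_
    simpa [MvPolynomial.totalDegree_X] using hS

/-- Every function on 𝔽₂^m is polynomial, so the 2^m square-free monomials span a space of dimension
2^m. -/
lemma linearIndependent_monomialFun :
    LinearIndependent (ZMod 2) (monomialFun : Finset (Fin m) → _) := by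
  apply linearIndependent_of_top_le_span_of_card_eq_finrank
  · intro f _
    have hf : f ∈ (MvPolynomial.restrictDegree (Fin m) (ZMod 2) (Fintype.card (ZMod 2) - 1)).map
        (MvPolynomial.evalₗ (ZMod 2) (Fin m)) := by
      rw [MvPolynomial.map_restrict_dom_evalₗ]
      trivial
    obtain ⟨p, -, rfl⟩ := hf
    rw [evalₗ_eq_sum_monomialFun]
    exact Submodule.sum_mem _ fun d _ =>
      Submodule.smul_mem _ _ (Submodule.subset_span ⟨_, rfl⟩)
  · simp

lemma finrank_reedMuller (r m : ℕ) :
    Module.finrank (ZMod 2) (reedMuller r m) =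
      Fintype.card {S : Finset (Fin m) // S.card ≤ r} := by
  rw [reedMuller_eq_span]
  exact finrank_span_eq_card
    (linearIndependent_monomialFun.comp (fun S : {S : Finset (Fin m) // S.card ≤ r} => S.1)
      Subtype.val_injective)

lemma card_subsets_card_le (m r : ℕ) :
    Fintype.card {S : Finset (Fin m) // S.card ≤ r} = ∑ i ∈ Finset.range (r + 1), m.choose i := by
  rw [Fintype.card_subtype, Finset.card_eq_sum_card_fiberwise (f := Finset.card)
    (t := Finset.range (r + 1)) (by intro S hS; simpa [Nat.lt_succ_iff] using hS)]
  refine Finset.sum_congr rfl fun i hi => ?_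
  have : (Finset.univ.filter fun S : Finset (Fin m) => S.card ≤ r).filter (fun S => S.card = i) =
      Finset.univ.powersetCard i := by
    ext S
    simp only [Finset.mem_filter, Finset.mem_univ, true_and, Finset.mem_powersetCard,
      Finset.subset_univ]
    rw [Finset.mem_range] at hi
    omega
  rw [this, Finset.card_powersetCard, Finset.card_univ, Fintype.card_fin]

/-- The Reed-Muller codes `RM(r, m)` and `RM(k, m)` with `r + k + 1 = m` have complementary
dimensions. -/
lemma finrank_reedMuller_add {r k : ℕ} (h : r + k + 1 = m) :
    Module.finrank (ZMod 2) (reedMuller r m) + Module.finrank (ZMod 2) (reedMuller k m) = 2 ^ m := by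
  rw [finrank_reedMuller, finrank_reedMuller, card_subsets_card_le, card_subsets_card_le,
    ← Nat.sum_range_choose m, ← Finset.sum_range_add_sum_Ico (fun i => m.choose i)
      (show r + 1 ≤ m + 1 by omega)]
  congr 1
  have hr := Finset.sum_Ico_reflect (fun i => m.choose i) 0 (show k + 1 ≤ m + 1 by omega)
  rw [Nat.sub_zero, show m + 1 - (k + 1) = r + 1 by omega] at hr
  rw [Finset.range_eq_Ico, ← hr]
  refine Finset.sum_congr rfl fun i hi => ?_
  rw [Finset.mem_Ico] at hi
  exact (Nat.choose_symm (by omega)).symm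

/-- The product of the two polynomials has degree below m, and such a polynomial sums to zero over
𝔽₂^m (the Chevalley–Warning argument). -/
lemma reedMuller_dotProduct_eq_zero {r k : ℕ} (h : r + k < m) {f g : (Fin m → ZMod 2) → ZMod 2}
    (hf : f ∈ reedMuller r m) (hg : g ∈ reedMuller k m) : f ⬝ᵥ g = 0 := by
  obtain ⟨p, hp, rfl⟩ := hf
  obtain ⟨q, hq, rfl⟩ := hg
  rw [SetLike.mem_coe, MvPolynomial.mem_restrictTotalDegree] at hp hq
  have hpq : (p * q).totalDegree < (Fintype.card (ZMod 2) - 1) * Fintype.card (Fin m) := by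
    rw [ZMod.card, Fintype.card_fin]
    have := MvPolynomial.totalDegree_mul p q
    omega
  simpa [dotProduct, MvPolynomial.evalₗ_apply] using MvPolynomial.sum_eval_eq_zero (p * q) hpq

lemma reedMuller_mono {r k : ℕ} (h : r ≤ k) : reedMuller r m ≤ reedMuller k m :=
  Submodule.map_mono fun p hp => by
    rw [MvPolynomial.mem_restrictTotalDegree] at hp ⊢
    exact hp.trans h

lemma dualCode_reedMuller {r k : ℕ} (h : r + k + 1 = m) :
    dualCode (reedMuller r m) = reedMuller k m := by
  symm
  apply Submodule.eq_of_le_of_finrank_eq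
  · intro g hg f hf
    exact reedMuller_dotProduct_eq_zero (by omega) hg hf
  · have h1 := finrank_add_finrank_dualCode (reedMuller r m)
    have h2 := finrank_reedMuller_add h
    rw [Fintype.card_fun, ZMod.card, Fintype.card_fin] at h1
    omega

lemma finrank_reedMuller_one (m : ℕ) : Module.finrank (ZMod 2) (reedMuller 1 m) = 1 + m := by
  simp [finrank_reedMuller, card_subsets_card_le, Finset.sum_range_succ]

lemma finrank_reedMuller_two (m : ℕ) :
    Module.finrank (ZMod 2) (reedMuller 2 m) = 1 + m + m.choose 2 := by
  simp [finrank_reedMuller, card_subsets_card_le, Finset.sum_range_succ]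

lemma monomialFun_mem_reedMuller {S : Finset (Fin m)} {r : ℕ} (hS : S.card ≤ r) :
    monomialFun S ∈ reedMuller r m := by
  rw [reedMuller_eq_span]
  exact Submodule.subset_span ⟨⟨S, hS⟩, rfl⟩

lemma sum_reedMuller_eq_zero {r : ℕ} (h : r < m) {f : (Fin m → ZMod 2) → ZMod 2}
    (hf : f ∈ reedMuller r m) : ∑ p, f p = 0 := by
  have := reedMuller_dotProduct_eq_zero (k := 0) (by omega) hf
    (monomialFun_mem_reedMuller (S := ∅) (by simp))
  simpa [dotProduct, monomialFun] using this

lemma sum_reedMuller_mul_mul_eq_zero {r : ℕ} (h : r + 2 < m) {f : (Fin m → ZMod 2) → ZMod 2}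
    (hf : f ∈ reedMuller r m) (i j : Fin m) : ∑ p, f p * (p i * p j) = 0 := by
  by_cases hij : i = j
  · subst hij
    have := reedMuller_dotProduct_eq_zero (k := 1) (by omega) hf
      (monomialFun_mem_reedMuller (S := {i}) (by simp))
    rw [← this]
    refine Finset.sum_congr rfl fun p _ => ?_
    rw [← sq, zmod_two_pow_eq_self _ two_ne_zero]
    simp [monomialFun]
  · have := reedMuller_dotProduct_eq_zero (k := 2) (by omega) hf
      (monomialFun_mem_reedMuller (S := {i, j}) (Finset.card_le_two))
    rw [← this]
    refine Finset.sum_congr rfl fun p _ => ?_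
    simp [monomialFun, Finset.prod_pair hij]

lemma linearMap_apply_eq_sum {W : Type*} [AddCommGroup W] [Module (ZMod 2) W]
    (L : (Fin m → ZMod 2) →ₗ[ZMod 2] W) (p : Fin m → ZMod 2) :
    L p = ∑ i, p i • L (Pi.single i 1) := by
  conv_lhs => rw [pi_eq_sum_univ' p]
  simp only [map_sum, map_smul]

lemma sum_reedMuller_smul_linear {r : ℕ} (h : r + 1 < m) {f : (Fin m → ZMod 2) → ZMod 2}
    (hf : f ∈ reedMuller r m) {W : Type*} [AddCommGroup W] [Module (ZMod 2) W]
    (L : (Fin m → ZMod 2) →ₗ[ZMod 2] W) : ∑ p, f p • L p = 0 := by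
  have key (i : Fin m) : ∑ p, f p * p i = 0 := by
    have := reedMuller_dotProduct_eq_zero (k := 1) (by omega) hf
      (monomialFun_mem_reedMuller (S := {i}) (by simp))
    simpa [dotProduct, monomialFun] using this
  calc ∑ p, f p • L p = ∑ p, ∑ i, (f p * p i) • L (Pi.single i 1) := by
        refine Finset.sum_congr rfl fun p _ => ?_
        rw [linearMap_apply_eq_sum L p]
        simp only [Finset.smul_sum, smul_smul]
    _ = 0 := by
        rw [Finset.sum_comm]
        simp only [← Finset.sum_smul, key, zero_smul, Finset.sum_const_zero]

/-- Coordinates of p ↦ B(p,p) have degree at most 2. A general target W covers both x^σ · x and the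
product of the half-bit with x. -/
lemma sum_reedMuller_smul_bilinear {r : ℕ} (h : r + 2 < m) {f : (Fin m → ZMod 2) → ZMod 2}
    (hf : f ∈ reedMuller r m) {W : Type*} [AddCommGroup W] [Module (ZMod 2) W]
    (B : (Fin m → ZMod 2) →ₗ[ZMod 2] (Fin m → ZMod 2) →ₗ[ZMod 2] W) :
    ∑ p, f p • B p p = 0 := by
  calc ∑ p, f p • B p p
      = ∑ p, ∑ i, ∑ j, (f p * (p i * p j)) • B (Pi.single i 1) (Pi.single j 1) := by
        refine Finset.sum_congr rfl fun p _ => ?_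
        have : B p p = ∑ i, ∑ j, (p i * p j) • B (Pi.single i 1) (Pi.single j 1) := by
          rw [linearMap_apply_eq_sum B p, LinearMap.sum_apply]
          refine Finset.sum_congr rfl fun i _ => ?_
          rw [LinearMap.smul_apply, linearMap_apply_eq_sum (B (Pi.single i 1)) p]
          simp only [Finset.smul_sum, smul_smul]
        rw [this, Finset.smul_sum]
        simp only [Finset.smul_sum, smul_smul]
    _ = 0 := by
        rw [Finset.sum_comm]
        refine Finset.sum_eq_zero fun i _ => ?_
        rw [Finset.sum_comm]
        refine Finset.sum_eq_zero fun j _ => ?_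
        rw [← Finset.sum_smul, sum_reedMuller_mul_mul_eq_zero h hf, zero_smul]

end ReedMuller

/-! ### Power functions on finite fields of characteristic two -/

section Field

variable {F : Type*} [Field F]

lemma charP_two_of_algebra (F : Type*) [Field F] [Algebra (ZMod 2) F] : CharP F 2 :=
  charP_of_injective_algebraMap (algebraMap (ZMod 2) F).injective 2

/-- The element is fixed by the k-th and the n-th power of Frobenius, hence by Frobenius itself
since gcd(k,n) = 1. -/
lemma eq_zero_or_one_of_pow_two_pow_eq_self [Fintype F] [CharP F 2] {n k : ℕ}
    (hF : Fintype.card F = 2 ^ n) (hk : k.Coprime n) {y : F} (hy : y ^ 2 ^ k = y) :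
    y = 0 ∨ y = 1 := by
  have h1 : Function.IsPeriodicPt (frobenius F 2) k y := by
    rw [Function.IsPeriodicPt, Function.IsFixedPt, iterate_frobenius, hy]
  have h2 : Function.IsPeriodicPt (frobenius F 2) n y := by
    rw [Function.IsPeriodicPt, Function.IsFixedPt, iterate_frobenius, ← hF, FiniteField.pow_card]
  have h3 := h1.gcd h2
  rw [hk.gcd_eq_one, Function.IsPeriodicPt, Function.IsFixedPt, iterate_frobenius, pow_one] at h3
  have h4 : y * (y - 1) = 0 := by linear_combination h3
  rcases mul_eq_zero.1 h4 with h | h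
  · exact Or.inl h
  · exact Or.inr (sub_eq_zero.1 h)

lemma coprime_two_mul {s n : ℕ} (hn : Odd n) (hs : s.Coprime n) : (2 * s).Coprime n :=
  Nat.Coprime.mul_left (Nat.coprime_two_left.2 hn) hs

/-- Applying the equation twice gives w^(σ²) = w. As n is odd, 2s is still coprime to n, so w is 0
or 1, and neither solves it. -/
lemma pow_two_pow_ne_add_one [Fintype F] [CharP F 2] {n s : ℕ} (hF : Fintype.card F = 2 ^ n)
    (hn : Odd n) (hs : s.Coprime n) (w : F) : w ^ 2 ^ s ≠ w + 1 := by
  intro h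
  have h2 : w ^ 2 ^ (2 * s) = w := by
    rw [two_mul, pow_add, pow_mul, h, add_pow_char_pow, h, one_pow, add_assoc,
      CharTwo.add_self_eq_zero, add_zero]
  have hs0 : 2 ^ s ≠ 0 := by positivity
  rcases eq_zero_or_one_of_pow_two_pow_eq_self hF (coprime_two_mul hn hs) h2 with rfl | rfl
  · simp [zero_pow hs0] at h
  · simp at h

lemma add_pow_two_pow_add_one [CharP F 2] (s : ℕ) (x y : F) :
    (x + y) ^ (2 ^ s + 1) =
      x ^ (2 ^ s + 1) + y ^ (2 ^ s + 1) + (x ^ 2 ^ s * y + x * y ^ 2 ^ s) := by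
  rw [pow_succ, add_pow_char_pow]
  ring

/-- The polar form vanishes at nonzero x, y only if x/y is fixed by the s-th power of Frobenius, so
x/y = 1. -/
lemma eq_of_pow_mul_add_mul_pow_eq_zero [Fintype F] [CharP F 2] {n s : ℕ}
    (hF : Fintype.card F = 2 ^ n) (hs : s.Coprime n) {x y : F} (hx : x ≠ 0) (hy : y ≠ 0)
    (h : x ^ 2 ^ s * y + x * y ^ 2 ^ s = 0) : x = y := by
  have h1 : (x / y) ^ 2 ^ s = x / y := by
    rw [div_pow, div_eq_div_iff (pow_ne_zero _ hy) hy]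
    exact CharTwo.add_eq_zero.1 h
  rcases eq_zero_or_one_of_pow_two_pow_eq_self hF hs h1 with h2 | h2
  · exact absurd h2 (div_ne_zero hx hy)
  · exact (div_eq_one_iff_eq hy).1 h2

lemma exists_ne_zero_ne_one [Fintype F] {n : ℕ} (hF : Fintype.card F = 2 ^ n) (hn : 2 ≤ n) :
    ∃ y : F, y ≠ 0 ∧ y ≠ 1 := by
  classical
  by_contra! h
  have h1 : (Finset.univ : Finset F) ⊆ {0, 1} := by
    intro y _
    by_cases hy : y = 0
    · simp [hy]
    · simp [h y hy]
  have h2 := (Finset.card_le_card h1).trans Finset.card_le_two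
  rw [Finset.card_univ, hF] at h2
  have := Nat.pow_le_pow_right (show 0 < 2 by norm_num) hn
  omega

end Field

/-! ### The syndrome of a binary word on a field -/

section Syndrome

variable {F : Type*} [Field F] [Fintype F] [Algebra (ZMod 2) F]

variable (F) in
/-- The syndrome `u ↦ (∑ u(x), ∑ u(x) x, ∑ u(x) x^(2^s + 1))` of a binary word on `F`. -/
def syndrome (s : ℕ) : (F → ZMod 2) →ₗ[ZMod 2] ZMod 2 × F × F :=
  Fintype.linearCombination (ZMod 2) fun x : F => ((1 : ZMod 2), x, x ^ (2 ^ s + 1))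

lemma syndrome_apply (s : ℕ) (u : F → ZMod 2) :
    syndrome F s u = (∑ x, u x, ∑ x, u x • x, ∑ x, u x • x ^ (2 ^ s + 1)) := by
  simp only [syndrome, Fintype.linearCombination_apply, Prod.smul_mk, smul_eq_mul, mul_one]
  ext <;> simp [Prod.fst_sum, Prod.snd_sum]

/-- Let a functional f kill all columns, with last component μ. Polarizing gives μ(x^σ y + x y^σ) =
0, and x = 1 gives μ(y^σ) = μ(y). Hence μ(x^σ (y + y^(σ²))) = 0; for y outside {0,1} the argument
runs over all of F, so μ = 0, and then f = 0. -/
lemma syndrome_surjective {n s : ℕ} (hF : Fintype.card F = 2 ^ n) (hn : Odd n) (hn2 : 2 ≤ n)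
    (hs : s.Coprime n) : Function.Surjective (syndrome F s) := by
  classical
  have := charP_two_of_algebra F
  rw [← LinearMap.range_eq_top]
  by_contra hne
  obtain ⟨f, hf0, hf⟩ := Submodule.exists_le_ker_of_lt_top _ (lt_top_iff_ne_top.2 hne)
  have hv (x : F) : f (1, x, x ^ (2 ^ s + 1)) = 0 := by
    apply hf
    exact ⟨Pi.single x 1, by simp [syndrome, Fintype.linearCombination_apply_single]⟩
  have h1 : f (1, 0, 0) = 0 := by simpa using hv 0
  have hv' (x : F) : f (0, x, x ^ (2 ^ s + 1)) = 0 := by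
    have : ((0 : ZMod 2), x, x ^ (2 ^ s + 1)) = (1, x, x ^ (2 ^ s + 1)) - (1, 0, 0) := by simp
    rw [this, map_sub, hv, h1, sub_zero]
  set μ : F → ZMod 2 := fun z => f (0, 0, z) with hμ
  have hμadd (a b : F) : μ (a + b) = μ a + μ b := by
    simp only [hμ, ← map_add]
    simp
  have hB (x y : F) : μ (x ^ 2 ^ s * y + x * y ^ 2 ^ s) = 0 := by
    have : ((0 : ZMod 2), (0 : F), x ^ 2 ^ s * y + x * y ^ 2 ^ s) =
        (0, x + y, (x + y) ^ (2 ^ s + 1)) - (0, x, x ^ (2 ^ s + 1)) - (0, y, y ^ (2 ^ s + 1)) := by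
      rw [add_pow_two_pow_add_one]
      refine Prod.ext (by simp) (Prod.ext (by simp) ?_)
      simp only [Prod.snd_sub]
      ring
    simp only [hμ]
    rw [this, map_sub, map_sub, hv', hv', hv', sub_zero, sub_zero]
  have hσ (y : F) : μ (y ^ 2 ^ s) = μ y := by
    have := hB 1 y
    rw [one_pow, one_mul, one_mul, hμadd] at this
    exact (CharTwo.add_eq_zero.1 this).symm
  obtain ⟨y, hy0, hy1⟩ := exists_ne_zero_ne_one hF hn2
  have hu : y + y ^ 2 ^ (2 * s) ≠ 0 := by
    intro h
    rcases eq_zero_or_one_of_pow_two_pow_eq_self hF (coprime_two_mul hn hs)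
      (CharTwo.add_eq_zero.1 h).symm with h | h
    · exact hy0 h
    · exact hy1 h
  have hμ0 (z : F) : μ z = 0 := by
    obtain ⟨x, hx⟩ := (iterateFrobeniusEquiv F 2 s).surjective (z / (y + y ^ 2 ^ (2 * s)))
    rw [iterateFrobeniusEquiv_def] at hx
    have hz : z = x ^ 2 ^ s * y + x ^ 2 ^ s * y ^ 2 ^ (2 * s) := by
      rw [hx]
      field_simp
    have h2 : x ^ 2 ^ s * y ^ 2 ^ (2 * s) = (x * y ^ 2 ^ s) ^ 2 ^ s := by
      rw [mul_pow, ← pow_mul, ← pow_add, two_mul]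
    rw [hz, h2, hμadd, hσ, ← hμadd, hB]
  apply hf0
  ext z
  · simpa [Prod.zero_eq_mk] using h1
  · have := hv' z
    have h2 : ((0 : ZMod 2), z, z ^ (2 ^ s + 1)) = (0, z, 0) + (0, 0, z ^ (2 ^ s + 1)) := by simp
    rw [h2, map_add] at this
    have h3 := hμ0 (z ^ (2 ^ s + 1))
    simp only [hμ] at h3
    rw [h3, add_zero] at this
    simpa using this
  · simpa using hμ0 z

end Syndrome

/-! ### Preparata words as pairs of words on the field -/

section Pairs

variable {F : Type*} [Field F] [Fintype F] [Algebra (ZMod 2) F]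

/-- The defining conditions of the Preparata code for the pair of words `u = c (·, 0)` and
`w = c (·, 1)`. -/
def IsPreparataPair (s : ℕ) (u w : F → ZMod 2) : Prop :=
  ∑ x, u x = 0 ∧ ∑ y, w y = 0 ∧ ∑ x, u x • x = ∑ y, w y • y ∧
    ∑ x, u x • x ^ (2 ^ s + 1) + (∑ x, u x • x) ^ (2 ^ s + 1) = ∑ y, w y • y ^ (2 ^ s + 1)

lemma zmod_two_eq_zero_or_one (z : ZMod 2) : z = 0 ∨ z = 1 := by
  fin_cases z
  · exact Or.inl rfl
  · exact Or.inr rfl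

lemma sum_smul_eq_sum_support {F M : Type*} [Fintype F] [AddCommGroup M] [Module (ZMod 2) M]
    (u : F → ZMod 2) (g : F → M) :
    ∑ x, u x • g x = ∑ x with u x ≠ 0, g x := by
  rw [Finset.sum_filter]
  refine Finset.sum_congr rfl fun x _ => ?_
  rcases zmod_two_eq_zero_or_one (u x) with h | h <;> simp [h]

lemma even_card_of_sum_eq_zero {ι : Type*} [Fintype ι] {u : ι → ZMod 2}
    (h : ∑ x, u x = 0) : Even (hammingNorm u) := by
  classical
  have h1 : ∑ x, u x = (hammingNorm u : ZMod 2) := by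
    rw [hammingNorm, Finset.card_eq_sum_ones, Nat.cast_sum, Finset.sum_filter]
    refine Finset.sum_congr rfl fun x _ => ?_
    rcases zmod_two_eq_zero_or_one (u x) with h | h <;> simp [h]
  rw [h1] at h
  exact (ZMod.natCast_eq_zero_iff_even).1 h

lemma sum_ne_zero_of_card_eq_two {F : Type*} [Field F] [CharP F 2] {U : Finset F} (hU : U.card = 2) :
    ∑ x ∈ U, x ≠ 0 := by
  classical
  obtain ⟨a, b, hab, rfl⟩ := Finset.card_eq_two.1 hU
  rw [Finset.sum_pair hab]
  exact fun h => hab (CharTwo.add_eq_zero.1 h)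

/-- The four points are a, a+x, a+y, a+x+y, and the sum of the quadratic map over them is its polar
form at (x,y); vanishing would force x = y. -/
lemma sum_pow_ne_zero_of_card_eq_four {F : Type*} [Field F] [Fintype F] [CharP F 2] {n s : ℕ} (hF : Fintype.card F = 2 ^ n)
    (hs : s.Coprime n) {U : Finset F} (hU : U.card = 4) (h1 : ∑ x ∈ U, x = 0) :
    ∑ x ∈ U, x ^ (2 ^ s + 1) ≠ 0 := by
  classical
  obtain ⟨a, T, haT, rfl, hT⟩ := Finset.card_eq_succ.1 hU
  obtain ⟨b, c, d, hbc, hbd, hcd, rfl⟩ := Finset.card_eq_three.1 hT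
  simp only [Finset.mem_insert, Finset.mem_singleton, not_or] at haT
  obtain ⟨hab, hac, had⟩ := haT
  have hsum {g : F → F} : ∑ x ∈ insert a {b, c, d}, g x = g a + (g b + (g c + g d)) := by
    rw [Finset.sum_insert (by simp [hab, hac, had]), Finset.sum_insert (by simp [hbc, hbd]),
      Finset.sum_pair hcd]
  rw [hsum] at h1 ⊢
  intro h2
  have two0 : (2 : F) = 0 := CharTwo.two_eq_zero
  obtain ⟨x, rfl⟩ : ∃ x, b = a + x := ⟨b - a, by ring⟩
  obtain ⟨y, rfl⟩ : ∃ y, c = a + y := ⟨c - a, by ring⟩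
  obtain rfl : d = a + (x + y) := by linear_combination h1 - (2 * a + x + y) * two0
  have hx : x ≠ 0 := fun h => hab (by rw [h, add_zero])
  have hy : y ≠ 0 := fun h => hac (by rw [h, add_zero])
  refine hbc (congrArg _ (eq_of_pow_mul_add_mul_pow_eq_zero hF hs hx hy ?_))
  simp only [add_pow_two_pow_add_one, add_pow_char_pow] at h2
  linear_combination h2 - (2 * a ^ (2 ^ s + 1) + x ^ (2 ^ s + 1) + y ^ (2 ^ s + 1)
    + a ^ 2 ^ s * x + a * x ^ 2 ^ s + a ^ 2 ^ s * y + a * y ^ 2 ^ s) * two0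

/-- With U = {a, a+β} and V = {a+z, a+z+β}, equality reads z^σ β + z β^σ = β^(σ+1), that is (z/β)^σ
= z/β + 1. -/
lemma not_isPreparataPair_two_two {F : Type*} [Field F] [Fintype F] [CharP F 2] {n s : ℕ} (hF : Fintype.card F = 2 ^ n)
    (hn : Odd n) (hs : s.Coprime n) {U V : Finset F} (hU : U.card = 2) (hV : V.card = 2)
    (h1 : ∑ x ∈ U, x = ∑ x ∈ V, x) :
    ∑ x ∈ U, x ^ (2 ^ s + 1) + (∑ x ∈ U, x) ^ (2 ^ s + 1) ≠ ∑ x ∈ V, x ^ (2 ^ s + 1) := by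
  classical
  obtain ⟨a, b, hab, rfl⟩ := Finset.card_eq_two.1 hU
  obtain ⟨c, d, hcd, rfl⟩ := Finset.card_eq_two.1 hV
  rw [Finset.sum_pair hab, Finset.sum_pair hcd] at *
  rw [Finset.sum_pair hab]
  intro h2
  have two0 : (2 : F) = 0 := CharTwo.two_eq_zero
  obtain ⟨β, rfl⟩ : ∃ x, b = a + x := ⟨b - a, by ring⟩
  obtain ⟨z, rfl⟩ : ∃ x, c = a + x := ⟨c - a, by ring⟩
  obtain rfl : d = a + z + β := by linear_combination -h1 - z * two0
  have hβ : β ≠ 0 := fun h => hab (by rw [h, add_zero])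
  refine pow_two_pow_ne_add_one hF hn hs (z / β) ?_
  rw [div_pow, div_add_one hβ, div_eq_div_iff (pow_ne_zero _ hβ) hβ]
  have h3 : a + (a + β) = β := by linear_combination a * two0
  rw [h3] at h2
  simp only [add_pow_two_pow_add_one, add_pow_char_pow] at h2
  linear_combination -h2 -
    (z * β ^ 2 ^ s + z ^ (2 ^ s + 1) + a ^ 2 ^ s * z + a * z ^ 2 ^ s) * two0

theorem IsPreparataPair.six_le_hammingNorm {n s : ℕ} (hF : Fintype.card F = 2 ^ n)
    (hn : Odd n) (hs : s.Coprime n) {u w : F → ZMod 2} (h : IsPreparataPair s u w)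
    (hne : ¬ (u = 0 ∧ w = 0)) : 6 ≤ hammingNorm u + hammingNorm w := by
  classical
  have := charP_two_of_algebra F
  obtain ⟨h1, h2, h3, h4⟩ := h
  have e1 := even_card_of_sum_eq_zero h1
  have e2 := even_card_of_sum_eq_zero h2
  simp only [sum_smul_eq_sum_support] at h3 h4
  rw [← hammingNorm_eq_zero, ← hammingNorm_eq_zero (x := w)] at hne
  unfold hammingNorm at *
  set U : Finset F := {x | u x ≠ 0}
  set V : Finset F := {x | w x ≠ 0}
  by_contra hlt
  have hs0 : 2 ^ s + 1 ≠ 0 := by positivity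
  -- Both cardinalities are even, not both zero, and their sum is below 6.
  have cases : (U.card = 0 ∧ V.card = 2) ∨ (U.card = 2 ∧ V.card = 0) ∨
      (U.card = 0 ∧ V.card = 4) ∨ (U.card = 4 ∧ V.card = 0) ∨ (U.card = 2 ∧ V.card = 2) := by
    obtain ⟨i, hi⟩ := e1
    obtain ⟨j, hj⟩ := e2
    omega
  rcases cases with ⟨hU, hV⟩ | ⟨hU, hV⟩ | ⟨hU, hV⟩ | ⟨hU, hV⟩ | ⟨hU, hV⟩
  · rw [Finset.card_eq_zero.1 hU, Finset.sum_empty] at h3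
    exact sum_ne_zero_of_card_eq_two hV h3.symm
  · rw [Finset.card_eq_zero.1 hV, Finset.sum_empty] at h3
    exact sum_ne_zero_of_card_eq_two hU h3
  · rw [Finset.card_eq_zero.1 hU, Finset.sum_empty] at h3
    rw [Finset.card_eq_zero.1 hU, Finset.sum_empty, Finset.sum_empty, zero_pow hs0, add_zero] at h4
    exact sum_pow_ne_zero_of_card_eq_four hF hs hV h3.symm h4.symm
  · rw [Finset.card_eq_zero.1 hV, Finset.sum_empty] at h3 h4
    rw [h3, zero_pow hs0, add_zero] at h4
    exact sum_pow_ne_zero_of_card_eq_four hF hs hU h3 h4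
  · exact not_isPreparataPair_two_two hF hn hs hU hV h3 h4

lemma sum_translate_smul {F : Type*} [Field F] [Fintype F] [CharP F 2] {M : Type*} [AddCommGroup M] [Module (ZMod 2) M] (α : F)
    (v : F → ZMod 2) (g : F → M) : ∑ x, v (x + α) • g x = ∑ x, v x • g (x + α) := by
  rw [← Equiv.sum_comp (Equiv.addRight α)]
  simp [add_assoc, CharTwo.add_self_eq_zero]

/-- The difference of two Preparata words is again a Preparata word after a translation of its first
half. -/
lemma IsPreparataPair.add_translate [CharP F 2] {s : ℕ} {u w u' w' : F → ZMod 2}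
    (h : IsPreparataPair s u w) (h' : IsPreparataPair s u' w') :
    IsPreparataPair s (fun x => (u + u') (x + ∑ z, u z • z)) (w + w') := by
  set α := ∑ z, u z • z with hα
  set α' := ∑ z, u' z • z with hα'
  obtain ⟨h1, h2, h3, h4⟩ := h
  obtain ⟨h1', h2', h3', h4'⟩ := h'
  rw [← hα] at h3 h4
  rw [← hα'] at h3' h4'
  have two0 : (2 : F) = 0 := CharTwo.two_eq_zero
  have hpar : ∑ x, (u + u') x = 0 := by
    simp only [Pi.add_apply, Finset.sum_add_distrib, h1, h1', add_zero]
  have hconst (z : F) : ∑ x, (u + u') x • z = 0 := by rw [← Finset.sum_smul, hpar, zero_smul]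
  have hlin : ∑ x, (u + u') x • x = α + α' := by
    simp only [Pi.add_apply, add_smul, Finset.sum_add_distrib, hα, hα']
  have hpow : ∑ x, (u + u') x • x ^ 2 ^ s = (α + α') ^ 2 ^ s := by
    rw [← hlin, sum_pow_char_pow]
    refine Finset.sum_congr rfl fun x _ => ?_
    rw [Algebra.smul_def, Algebra.smul_def, mul_pow, ← map_pow,
      zmod_two_pow_eq_self _ (by positivity)]
  -- Even weight makes the linear sum invariant under translation.
  have hS : ∑ x, (u + u') (x + α) • x = α + α' := by
    rw [sum_translate_smul]
    simp only [smul_add, Finset.sum_add_distrib, hlin, hconst, add_zero]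
  refine ⟨?_, ?_, ?_, ?_⟩
  · rw [← hpar]
    exact Equiv.sum_comp (Equiv.addRight α) (u + u')
  · simp only [Pi.add_apply, Finset.sum_add_distrib, h2, h2', add_zero]
  · rw [hS, h3, h3']
    simp only [Pi.add_apply, add_smul, Finset.sum_add_distrib]
  · rw [hS, sum_translate_smul]
    have hw : ∑ y, (w + w') y • y ^ (2 ^ s + 1) =
        ∑ y, w y • y ^ (2 ^ s + 1) + ∑ y, w' y • y ^ (2 ^ s + 1) := by
      simp only [Pi.add_apply, add_smul, Finset.sum_add_distrib]
    rw [hw, ← h4, ← h4']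
    -- The translation by α adds the polar form at (α + α', α), which equals that at (α', α). This
    -- cancels the cross term in (α + α')^(σ+1), leaving the two original equations added together.
    have hq : ∑ x, (u + u') x • (x + α) ^ (2 ^ s + 1) = ∑ x, u x • x ^ (2 ^ s + 1) +
        ∑ x, u' x • x ^ (2 ^ s + 1) + ((α + α') ^ 2 ^ s * α + (α + α') * α ^ 2 ^ s) := by
      simp only [add_pow_two_pow_add_one s _ α, smul_add, Finset.sum_add_distrib, hconst, add_zero]
      rw [← hpow, ← hlin, Finset.sum_mul, Finset.sum_mul]
      simp only [smul_mul_assoc, Pi.add_apply, add_smul, add_mul, Finset.sum_add_distrib]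
    rw [hq, add_pow_two_pow_add_one, add_pow_char_pow]
    linear_combination (α ^ 2 ^ s * α + α' ^ 2 ^ s * α + α' * α ^ 2 ^ s) * two0

lemma isPreparataPair_zero (s : ℕ) : IsPreparataPair s (0 : F → ZMod 2) 0 := by
  simp [IsPreparataPair]

/-- For a fixed even u, membership only prescribes the syndrome of w; both existence and counting of
words rest on this. -/
lemma isPreparataPair_iff_syndrome {s : ℕ} {u w : F → ZMod 2} :
    IsPreparataPair s u w ↔ ∑ x, u x = 0 ∧ syndrome F s w =
      (0, ∑ x, u x • x, ∑ x, u x • x ^ (2 ^ s + 1) + (∑ x, u x • x) ^ (2 ^ s + 1)) := by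
  rw [syndrome_apply, Prod.mk.injEq, Prod.mk.injEq, IsPreparataPair]
  constructor
  · rintro ⟨h1, h2, h3, h4⟩
    exact ⟨h1, h2, h3.symm, h4.symm⟩
  · rintro ⟨h1, h2, h3, h4⟩
    exact ⟨h1, h2, h3.symm, h4.symm⟩

lemma exists_isPreparataPair_sum_eq {n s : ℕ} (hF : Fintype.card F = 2 ^ n)
    (hn : Odd n) (hn2 : 2 ≤ n) (hs : s.Coprime n) (α : F) :
    ∃ u w : F → ZMod 2, IsPreparataPair s u w ∧ ∑ x, u x • x = α := by
  obtain ⟨u, hu⟩ := syndrome_surjective hF hn hn2 hs (0, α, 0)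
  rw [syndrome_apply, Prod.mk.injEq, Prod.mk.injEq] at hu
  obtain ⟨w, hw⟩ := syndrome_surjective hF hn hn2 hs
    (0, ∑ x, u x • x, ∑ x, u x • x ^ (2 ^ s + 1) + (∑ x, u x • x) ^ (2 ^ s + 1))
  exact ⟨u, w, isPreparataPair_iff_syndrome.2 ⟨hu.1, hw⟩, hu.2.1⟩

/-- The Preparata code is not closed under addition. -/
lemma exists_isPreparataPair_add_not {n s : ℕ} (hF : Fintype.card F = 2 ^ n)
    (hn : Odd n) (hn2 : 2 ≤ n) (hs : s.Coprime n) :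
    ∃ u w u' w' : F → ZMod 2, IsPreparataPair s u w ∧ IsPreparataPair s u' w' ∧
      ¬ IsPreparataPair s (u + u') (w + w') := by
  have := charP_two_of_algebra F
  -- Words with linear sums 1 and y are used: if their sum were a codeword, the polar form would
  -- vanish at (y, 1), forcing y = 1.
  obtain ⟨y, hy0, hy1⟩ := exists_ne_zero_ne_one hF hn2
  obtain ⟨u, w, h, hα⟩ := exists_isPreparataPair_sum_eq hF hn hn2 hs (1 : F)
  obtain ⟨u', w', h', hα'⟩ := exists_isPreparataPair_sum_eq hF hn hn2 hs y
  refine ⟨u, w, u', w', h, h', fun hc => hy1 ?_⟩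
  obtain ⟨-, -, -, h4⟩ := h
  obtain ⟨-, -, -, h4'⟩ := h'
  obtain ⟨-, -, -, h5⟩ := hc
  simp only [Pi.add_apply, add_smul, Finset.sum_add_distrib] at h5
  rw [hα, hα', add_pow_two_pow_add_one] at h5
  rw [hα] at h4
  rw [hα'] at h4'
  refine eq_of_pow_mul_add_mul_pow_eq_zero hF hs hy0 one_ne_zero ?_
  linear_combination h5 - h4' - h4

/-- The Preparata code has a word of weight six with support in one half. -/
lemma exists_isPreparataPair_weight_six {n s : ℕ} (hF : Fintype.card F = 2 ^ n)
    (hn : Odd n) (hn5 : 5 ≤ n) (hs : s.Coprime n) :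
    ∃ w : F → ZMod 2, IsPreparataPair s 0 w ∧ hammingNorm w = 6 := by
  classical
  have := charP_two_of_algebra F
  set q := Fintype.card F with hq
  have hq32 : 32 ≤ q := by
    rw [hF]
    exact Nat.pow_le_pow_right (show 0 < 2 by norm_num) hn5
  -- Pigeonhole: there are more triples than pairs of values (sum, power sum), as (q-1)(q-2) > 6q
  -- for q ≥ 32. Two triples with the same values have a symmetric difference of size at most 6, and
  -- the weight bound makes it exactly 6.
  have hcard : (Finset.univ : Finset (F × F)).card <
      (Finset.powersetCard 3 (Finset.univ : Finset F)).card := by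
    rw [Finset.card_powersetCard, Finset.card_univ, Finset.card_univ, Fintype.card_prod, ← hq]
    obtain ⟨k, hk⟩ : ∃ k, q = k + 3 := ⟨q - 3, by omega⟩
    have h6 := Nat.descFactorial_eq_factorial_mul_choose q 3
    have h7 : q.descFactorial 3 = (q - 2) * ((q - 1) * q) := by
      simp [Nat.descFactorial_succ]
    rw [h7, hk] at h6
    simp only [Nat.factorial, show k + 3 - 2 = k + 1 by omega,
      show k + 3 - 1 = k + 2 by omega] at h6
    rw [hk]
    nlinarith
  obtain ⟨A, hA, B, hB, hAB, hfAB⟩ := Finset.exists_ne_map_eq_of_card_lt_of_maps_to hcard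
    (f := fun A => (∑ x ∈ A, x, ∑ x ∈ A, x ^ (2 ^ s + 1))) (fun _ _ => Finset.mem_univ _)
  rw [Finset.mem_powersetCard] at hA hB
  obtain ⟨hf1, hf2⟩ := Prod.mk.inj hfAB
  let ind (S : Finset F) : F → ZMod 2 := fun x => if x ∈ S then 1 else 0
  have hind (S : Finset F) (g : F → F) :
      ∑ x, ind S x • g x = ∑ x ∈ S, g x := by
    simp [ind, ite_smul]
  have hindS (S : Finset F) : ∑ x, ind S x = (S.card : ZMod 2) := by simp [ind]
  have hw : IsPreparataPair s 0 (ind A + ind B) := by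
    simp only [IsPreparataPair, Pi.zero_apply, zero_smul, Finset.sum_const_zero, Pi.add_apply,
      add_smul, Finset.sum_add_distrib, hind, hindS, hA.2, hB.2, hf1, hf2,
      CharTwo.add_self_eq_zero, true_and]
    simp [zero_pow]
  have hne : ind A + ind B ≠ 0 := by
    intro h
    apply hAB
    ext x
    have := congrFun h x
    by_cases hxA : x ∈ A <;> by_cases hxB : x ∈ B <;> simp_all [ind]
  refine ⟨_, hw, le_antisymm ?_ ?_⟩
  · have hsub : (Finset.univ.filter fun x => (ind A + ind B) x ≠ 0) ⊆ A ∪ B := by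
      intro x hx
      by_contra hx'
      rw [Finset.mem_union, not_or] at hx'
      simp [ind, hx'.1, hx'.2] at hx
    have h1 := (Finset.card_le_card hsub).trans (Finset.card_union_le A B)
    rw [hA.2, hB.2] at h1
    exact h1
  · have := hw.six_le_hammingNorm hF hn hs (fun h => hne h.2)
    simpa using this

end Pairs

/-! ### The Preparata code -/

section Preparata

variable {m : ℕ} {F : Type*} [Field F] [Algebra (ZMod 2) F]

/-- The two halves of a word on `𝔽₂^m`, identified with `F × 𝔽₂`. -/
def halves (e : (Fin m → ZMod 2) ≃ₗ[ZMod 2] F × ZMod 2) :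
    ((Fin m → ZMod 2) → ZMod 2) ≃ (F → ZMod 2) × (F → ZMod 2) where
  toFun c := (fun x => c (e.symm (x, 0)), fun x => c (e.symm (x, 1)))
  invFun p := fun v => if (e v).2 = 0 then p.1 (e v).1 else p.2 (e v).1
  left_inv c := by
    ext v
    obtain ⟨⟨x, i⟩, rfl⟩ := e.symm.surjective v
    rcases zmod_two_eq_zero_or_one i with rfl | rfl <;> simp
  right_inv p := by ext x <;> simp

lemma halves_add (e : (Fin m → ZMod 2) ≃ₗ[ZMod 2] F × ZMod 2) (c c' : (Fin m → ZMod 2) → ZMod 2) :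
    halves e (c + c') = halves e c + halves e c' := rfl

lemma halves_zero (e : (Fin m → ZMod 2) ≃ₗ[ZMod 2] F × ZMod 2) : halves e 0 = 0 := rfl

variable [Fintype F]

lemma mem_preparata_iff {e : (Fin m → ZMod 2) ≃ₗ[ZMod 2] F × ZMod 2} {s : ℕ}
    {c : (Fin m → ZMod 2) → ZMod 2} :
    c ∈ preparata e s ↔ IsPreparataPair s (halves e c).1 (halves e c).2 := Iff.rfl

lemma sum_eq_sum_halves {M : Type*} [AddCommMonoid M]
    (e : (Fin m → ZMod 2) ≃ₗ[ZMod 2] F × ZMod 2) (g : (Fin m → ZMod 2) → M) :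
    ∑ p, g p = ∑ x, g (e.symm (x, 0)) + ∑ x, g (e.symm (x, 1)) := by
  rw [← Equiv.sum_comp e.symm.toEquiv g, Fintype.sum_prod_type_right]
  exact Fin.sum_univ_two (fun i : ZMod 2 => ∑ x, g (e.symm (x, i)))

lemma hammingNorm_eq_sum {ι : Type*} [Fintype ι] (c : ι → ZMod 2) :
    hammingNorm c = ∑ p, if c p ≠ 0 then 1 else 0 := by
  rw [hammingNorm, Finset.card_filter]

lemma hammingNorm_eq_add_halves (e : (Fin m → ZMod 2) ≃ₗ[ZMod 2] F × ZMod 2)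
    (c : (Fin m → ZMod 2) → ZMod 2) :
    hammingNorm c = hammingNorm (halves e c).1 + hammingNorm (halves e c).2 := by
  rw [hammingNorm_eq_sum, hammingNorm_eq_sum, hammingNorm_eq_sum, sum_eq_sum_halves e]
  rfl

lemma zero_mem_preparata (e : (Fin m → ZMod 2) ≃ₗ[ZMod 2] F × ZMod 2) (s : ℕ) :
    0 ∈ preparata e s :=
  mem_preparata_iff.2 (isPreparataPair_zero s)

/-- The minimum distance of the Preparata code is at least six. -/
theorem six_le_hammingNorm_add_of_mem_preparata {n s : ℕ} (hF : Fintype.card F = 2 ^ n)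
    (hn : Odd n) (hs : s.Coprime n) {e : (Fin m → ZMod 2) ≃ₗ[ZMod 2] F × ZMod 2}
    {c c' : (Fin m → ZMod 2) → ZMod 2} (hc : c ∈ preparata e s) (hc' : c' ∈ preparata e s)
    (hne : c + c' ≠ 0) : 6 ≤ hammingNorm (c + c') := by
  have := charP_two_of_algebra F
  rw [mem_preparata_iff] at hc hc'
  have h := hc.add_translate hc'
  rw [hammingNorm_eq_add_halves e]
  set α := ∑ z, (halves e c).1 z • z
  -- The translation only permutes the coordinates of the first half.
  have hw : hammingNorm (fun x => ((halves e c).1 + (halves e c').1) (x + α)) =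
      hammingNorm (halves e (c + c')).1 := by
    rw [hammingNorm_eq_sum, hammingNorm_eq_sum]
    exact Equiv.sum_comp (Equiv.addRight α)
      (fun x => if ((halves e c).1 + (halves e c').1) x ≠ 0 then 1 else 0)
  rw [← hw]
  refine h.six_le_hammingNorm hF hn hs ?_
  rintro ⟨h1, h2⟩
  apply hne
  apply (halves e).injective
  rw [halves_zero]
  refine Prod.ext ?_ h2
  ext x
  have h3 := congrFun h1 (x + α)
  simpa [halves_add, add_assoc, CharTwo.add_self_eq_zero] using h3

lemma exists_mem_preparata_hammingNorm_eq_six {n s : ℕ} (hF : Fintype.card F = 2 ^ n)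
    (hn : Odd n) (hn5 : 5 ≤ n) (hs : s.Coprime n)
    (e : (Fin m → ZMod 2) ≃ₗ[ZMod 2] F × ZMod 2) : ∃ c ∈ preparata e s, hammingNorm c = 6 := by
  obtain ⟨w, hw, h6⟩ := exists_isPreparataPair_weight_six hF hn hn5 hs
  refine ⟨(halves e).symm (0, w), ?_, ?_⟩
  · rwa [mem_preparata_iff, Equiv.apply_symm_apply]
  · rw [hammingNorm_eq_add_halves e, Equiv.apply_symm_apply, hammingNorm_zero, zero_add, h6]

lemma exists_mem_preparata_add_notMem {n s : ℕ} (hF : Fintype.card F = 2 ^ n)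
    (hn : Odd n) (hn2 : 2 ≤ n) (hs : s.Coprime n)
    (e : (Fin m → ZMod 2) ≃ₗ[ZMod 2] F × ZMod 2) :
    ∃ c ∈ preparata e s, ∃ c' ∈ preparata e s, c + c' ∉ preparata e s := by
  obtain ⟨u, w, u', w', h, h', hnot⟩ := exists_isPreparataPair_add_not hF hn hn2 hs
  refine ⟨(halves e).symm (u, w), ?_, (halves e).symm (u', w'), ?_, ?_⟩
  · rwa [mem_preparata_iff, Equiv.apply_symm_apply]
  · rwa [mem_preparata_iff, Equiv.apply_symm_apply]
  · rwa [mem_preparata_iff, halves_add, Equiv.apply_symm_apply, Equiv.apply_symm_apply]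

/-- The Preparata code is invariant under translations by `RM(m - 3, m)`. -/
theorem add_mem_preparata {r s : ℕ} (hr : r + 2 < m) {e : (Fin m → ZMod 2) ≃ₗ[ZMod 2] F × ZMod 2}
    {c f : (Fin m → ZMod 2) → ZMod 2} (hc : c ∈ preparata e s) (hf : f ∈ reedMuller r m) :
    c + f ∈ preparata e s := by
  have := charP_two_of_algebra F
  rw [mem_preparata_iff] at hc ⊢
  obtain ⟨h1, h2, h3, h4⟩ := hc
  let pr₁ : (Fin m → ZMod 2) →ₗ[ZMod 2] F := LinearMap.fst (ZMod 2) F (ZMod 2) ∘ₗ e.toLinearMap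
  let pr₂ : (Fin m → ZMod 2) →ₗ[ZMod 2] ZMod 2 :=
    LinearMap.snd (ZMod 2) F (ZMod 2) ∘ₗ e.toLinearMap
  let frob : F →ₗ[ZMod 2] F := (iterateFrobenius F 2 s).toAddMonoidHom.toZModLinearMap 2
  -- The factor `pr₂` isolates the second half, so the parity and the linear sum of f vanish on each
  -- half. For x^(σ+1) that factor would have degree 3 in all; only the total over both halves
  -- vanishes, which is enough because the code compares the halves.
  have s1 := sum_reedMuller_eq_zero (show r < m by omega) hf
  have s2 := sum_reedMuller_smul_linear (show r + 1 < m by omega) hf pr₂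
  have s3 := sum_reedMuller_smul_linear (show r + 1 < m by omega) hf pr₁
  have s4 := sum_reedMuller_smul_bilinear hr hf
    ((LinearMap.lsmul (ZMod 2) F).compl₁₂ pr₂ pr₁)
  have s5 := sum_reedMuller_smul_bilinear hr hf
    ((LinearMap.mul (ZMod 2) F).compl₁₂ (frob ∘ₗ pr₁) pr₁)
  rw [sum_eq_sum_halves e] at s1 s2 s3 s4 s5
  have hfr (x : F) : frob x = x ^ 2 ^ s := rfl
  simp only [pr₁, pr₂, LinearMap.compl₁₂_apply, LinearMap.comp_apply, LinearEquiv.coe_coe,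
    LinearEquiv.apply_symm_apply, LinearMap.fst_apply, LinearMap.snd_apply,
    LinearMap.lsmul_apply, LinearMap.mul_apply', hfr, zero_smul, smul_zero,
    Finset.sum_const_zero, zero_add, one_smul, smul_eq_mul, mul_one, mul_zero, ← pow_succ] at s2 s3 s4 s5
  rw [s2, add_zero] at s1
  rw [s4, add_zero] at s3
  have t5 := CharTwo.add_eq_zero.1 s5
  rw [halves_add]
  have hfst (x : F) : (halves e f).1 x = f (e.symm (x, 0)) := rfl
  have hsnd (x : F) : (halves e f).2 x = f (e.symm (x, 1)) := rfl
  simp only [IsPreparataPair, Prod.fst_add, Prod.snd_add, Pi.add_apply, add_smul,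
    Finset.sum_add_distrib, hfst, hsnd, s1, s2, s3, s4, h1, h2, h3, add_zero, true_and]
  rw [← h4, h3, t5]
  ring

lemma finrank_field {n : ℕ} (hF : Fintype.card F = 2 ^ n) : Module.finrank (ZMod 2) F = n := by
  have h := Module.card_eq_pow_finrank (K := ZMod 2) (V := F)
  rw [hF, ZMod.card] at h
  exact (Nat.pow_right_injective le_rfl h).symm

/-- The Preparata code of length `2^m` has `2^(2^m - 2m)` words. -/
theorem ncard_preparata {n s : ℕ} (hF : Fintype.card F = 2 ^ n)
    (hn : Odd n) (hn2 : 2 ≤ n) (hs : s.Coprime n)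
    (e : (Fin m → ZMod 2) ≃ₗ[ZMod 2] F × ZMod 2) :
    (preparata e s).ncard * 2 ^ (2 * n + 2) = 2 ^ (2 * 2 ^ n) := by
  classical
  have := charP_two_of_algebra F
  have hsurj := syndrome_surjective hF hn hn2 hs
  let sec := Function.surjInv hsurj
  have hsec z : syndrome F s (sec z) = z := Function.surjInv_eq hsurj z
  let S := syndrome F s
  -- Subtracting from w a word whose syndrome is the nonlinear term straightens P into the kernel of
  -- the linear map `L`, whose rank is 2n + 2.
  let corr (u : F → ZMod 2) : F → ZMod 2 := sec (0, 0, (∑ x, u x • x) ^ (2 ^ s + 1))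
  let L : (F → ZMod 2) × (F → ZMod 2) →ₗ[ZMod 2] ZMod 2 × ZMod 2 × F × F :=
    (LinearMap.fst (ZMod 2) (ZMod 2) (F × F) ∘ₗ S ∘ₗ LinearMap.fst (ZMod 2) _ _).prod
      (S ∘ₗ LinearMap.snd (ZMod 2) _ _ - S ∘ₗ LinearMap.fst (ZMod 2) _ _)
  have hLa (u w : F → ZMod 2) : L (u, w) = ((S u).1, S w - S u) := rfl
  let T : (F → ZMod 2) × (F → ZMod 2) ≃ (F → ZMod 2) × (F → ZMod 2) :=
    { toFun := fun p => (p.1, p.2 - corr p.1)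
      invFun := fun p => (p.1, p.2 + corr p.1)
      left_inv := fun p => by simp
      right_inv := fun p => by simp }
  have hL : Function.Surjective L := by
    rintro ⟨a, z⟩
    obtain ⟨u, hu⟩ := hsurj (a, 0, 0)
    obtain ⟨w, hw⟩ := hsurj (z + (a, 0, 0))
    exact ⟨(u, w), by rw [hLa]; simp [S, hu, hw]⟩
  have hmem (c : (Fin m → ZMod 2) → ZMod 2) :
      c ∈ preparata e s ↔ T (halves e c) ∈ LinearMap.ker L := by
    rw [mem_preparata_iff, isPreparataPair_iff_syndrome]
    generalize halves e c = p
    obtain ⟨u, w⟩ := p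
    have hT : T (u, w) = (u, w - corr u) := rfl
    rw [hT, LinearMap.mem_ker, hLa, Prod.mk_eq_zero]
    simp only [S, corr, map_sub, hsec]
    rw [syndrome_apply s u]
    refine and_congr_right fun h0 => ?_
    rw [sub_sub, sub_eq_zero, h0]
    simp [add_comm]
  have hcard : (preparata e s).ncard = Nat.card (LinearMap.ker L) := by
    rw [← Nat.card_coe_set_eq]
    exact Nat.card_congr (((halves e).trans T).subtypeEquiv hmem)
  have hrk := LinearMap.finrank_range_add_finrank_ker L
  rw [LinearMap.range_eq_top.2 hL, finrank_top] at hrk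
  simp only [Module.finrank_prod, Module.finrank_self, finrank_field hF,
    Module.finrank_fintype_fun_eq_card, hF] at hrk
  rw [hcard, Module.natCard_eq_pow_finrank (K := ZMod 2), Nat.card_zmod, ← pow_add]
  congr 1
  omega

end Preparata

/-! ### Coset decompositions -/

section Cosets

variable {ι : Type*} {C : Submodule (ZMod 2) (ι → ZMod 2)}

lemma exists_isCosetDecomposition [Fintype ι] {S : Set (ι → ZMod 2)}
    (hS : ∀ c ∈ S, ∀ r ∈ C, c + r ∈ S) : ∃ T, IsCosetDecomposition C T S := by
  classical
  let rep (v : ι → ZMod 2) : ι → ZMod 2 := (Submodule.Quotient.mk (p := C) v).out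
  have hrep (v : ι → ZMod 2) : Submodule.Quotient.mk (p := C) (rep v) = Submodule.Quotient.mk v :=
    Quotient.out_eq _
  refine ⟨S.toFinset.image rep, fun v => ⟨fun hv => ?_, ?_⟩, ?_⟩
  · refine ⟨rep v, Finset.mem_image_of_mem _ (Set.mem_toFinset.2 hv), ?_⟩
    rw [← Submodule.Quotient.eq, hrep]
  · rintro ⟨t, ht, hvt⟩
    obtain ⟨v', hv', rfl⟩ := Finset.mem_image.1 ht
    rw [← Submodule.Quotient.eq, hrep, Submodule.Quotient.eq] at hvt
    simpa using hS v' (Set.mem_toFinset.1 hv') _ hvt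
  · intro t ht t' ht' h
    obtain ⟨v, -, rfl⟩ := Finset.mem_image.1 ht
    obtain ⟨v', -, rfl⟩ := Finset.mem_image.1 ht'
    rw [← Submodule.Quotient.eq, hrep, hrep] at h
    simp only [rep, h]

lemma IsCosetDecomposition.card_mul [Fintype ι] {T : Finset (ι → ZMod 2)} {S : Set (ι → ZMod 2)}
    (h : IsCosetDecomposition C T S) : T.card * Nat.card C = S.ncard := by
  let f : T × C → S := fun p => ⟨p.1 + p.2, (h.1 _).2 ⟨p.1, p.1.2, by simp⟩⟩
  have hf : Function.Bijective f := by
    constructor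
    · rintro ⟨⟨t, ht⟩, ⟨r, hr⟩⟩ ⟨⟨t', ht'⟩, ⟨r', hr'⟩⟩ heq
      have heq' : t + r = t' + r' := congrArg Subtype.val heq
      obtain rfl : t = t' := by
        refine h.2 t ht t' ht' ?_
        have : t - t' = r' - r := by
          rw [sub_eq_sub_iff_add_eq_add, heq', add_comm]
        rw [this]
        exact C.sub_mem hr' hr
      simpa using heq'
    · rintro ⟨v, hv⟩
      obtain ⟨t, ht, hvt⟩ := (h.1 v).1 hv
      exact ⟨(⟨t, ht⟩, ⟨v - t, hvt⟩), by simp [f]⟩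
  rw [← Nat.card_coe_set_eq, ← Nat.card_congr (Equiv.ofBijective f hf), Nat.card_prod,
    Nat.card_eq_fintype_card (α := T), Fintype.card_coe]

end Cosets

/-! ### Pauli operators -/

section Pauli

/-- The sign `(-1)^z` of a bit `z`. -/
noncomputable def sgn (z : ZMod 2) : ℂ := (-1) ^ z.val

@[simp] lemma sgn_zero : sgn 0 = 1 := by simp [sgn]

@[simp] lemma sgn_one : sgn 1 = -1 := by simp [sgn, ZMod.val_one]

lemma sgn_add (z w : ZMod 2) : sgn (z + w) = sgn z * sgn w := by
  rcases zmod_two_eq_zero_or_one z with rfl | rfl <;>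
  rcases zmod_two_eq_zero_or_one w with rfl | rfl <;>
  simp [CharTwo.add_self_eq_zero]

lemma sgn_mul_self (z : ZMod 2) : sgn z * sgn z = 1 := by
  rw [← sgn_add, CharTwo.add_self_eq_zero, sgn_zero]

lemma conj_sgn (z : ZMod 2) : starRingEnd ℂ (sgn z) = sgn z := by simp [sgn]

variable {ι : Type*} [Fintype ι] [DecidableEq ι]

lemma pauliOp_apply (a b : ι → ZMod 2) (ψ : Qubits ι) (x : ι → ZMod 2) :
    pauliOp a b ψ x = sgn (b ⬝ᵥ (x + a)) * ψ (x + a) := rfl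

lemma pauliOp_zero_zero (ψ : Qubits ι) : pauliOp 0 0 ψ = ψ := by
  ext x
  simp [pauliOp_apply]

lemma pauliOp_pauliOp (a b c d : ι → ZMod 2) (ψ : Qubits ι) :
    pauliOp a b (pauliOp c d ψ) = sgn (b ⬝ᵥ c) • pauliOp (a + c) (b + d) ψ := by
  ext x
  rw [PiLp.smul_apply, smul_eq_mul, pauliOp_apply, pauliOp_apply, pauliOp_apply, ← mul_assoc,
    ← mul_assoc, ← sgn_add, ← sgn_add, add_assoc x a c]
  congr 2
  have : b ⬝ᵥ c + b ⬝ᵥ c = 0 := CharTwo.add_self_eq_zero _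
  simp only [add_dotProduct, dotProduct_add]
  linear_combination -this

lemma pauliOp_comm (a b c d : ι → ZMod 2) (ψ : Qubits ι) :
    pauliOp a b (pauliOp c d ψ) = sgn (b ⬝ᵥ c + d ⬝ᵥ a) • pauliOp c d (pauliOp a b ψ) := by
  rw [pauliOp_pauliOp, pauliOp_pauliOp, smul_smul, sgn_add, mul_assoc, sgn_mul_self, mul_one,
    add_comm c, add_comm d]

lemma pauliOp_self (a b : ι → ZMod 2) (ψ : Qubits ι) :
    pauliOp a b (pauliOp a b ψ) = sgn (b ⬝ᵥ a) • ψ := by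
  have h (v : ι → ZMod 2) : v + v = 0 := by
    ext i
    exact CharTwo.add_self_eq_zero _
  rw [pauliOp_pauliOp, h, h, pauliOp_zero_zero]

lemma inner_pauliOp_pauliOp (a b : ι → ZMod 2) (φ ψ : Qubits ι) :
    inner ℂ (pauliOp a b φ) (pauliOp a b ψ) = inner ℂ φ ψ := by
  rw [PiLp.inner_apply, PiLp.inner_apply,
    ← Equiv.sum_comp (Equiv.addRight a) (fun x => inner ℂ (φ x) (ψ x))]
  refine Finset.sum_congr rfl fun x _ => ?_
  simp only [pauliOp_apply, RCLike.inner_apply, map_mul, conj_sgn, Equiv.coe_addRight]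
  linear_combination (ψ (x + a) * starRingEnd ℂ (φ (x + a))) * sgn_mul_self (b ⬝ᵥ (x + a))

lemma pauliOp_injective (a b : ι → ZMod 2) : Function.Injective (pauliOp a b) := by
  refine (injective_iff_map_eq_zero _).2 fun ψ h => ?_
  rw [← inner_self_eq_zero (𝕜 := ℂ), ← inner_pauliOp_pauliOp a b, h, inner_zero_left]

/-- A Pauli operator that maps some nonzero vector of a stabilizer code into the code preserves the
code. -/
lemma IsStabilizerCode.pauliOp_mem {Q : Submodule ℂ (Qubits ι)} (hQ : IsStabilizerCode Q)
    {a b : ι → ZMod 2} {ψ φ : Qubits ι} (hψ : ψ ∈ Q) (hψ0 : ψ ≠ 0) (hE : pauliOp a b ψ ∈ Q)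
    (hφ : φ ∈ Q) : pauliOp a b φ ∈ Q := by
  obtain ⟨-, S, hP, -, hS⟩ := hQ
  rw [hS] at hψ hE hφ ⊢
  intro g hg
  obtain ⟨k, c, d, rfl⟩ := hP g hg
  have key (χ : Qubits ι) : (Complex.I ^ k • pauliOp c d) (pauliOp a b χ) =
      sgn (d ⬝ᵥ a + b ⬝ᵥ c) • pauliOp a b ((Complex.I ^ k • pauliOp c d) χ) := by
    rw [LinearMap.smul_apply, LinearMap.smul_apply, pauliOp_comm c d a b, map_smul, smul_comm]
  have h1 := hE _ hg
  rw [key, hψ _ hg] at h1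
  -- Pauli operators commute up to sign; g fixes both ψ and its nonzero image, so the sign is +1.
  have h2 : sgn (d ⬝ᵥ a + b ⬝ᵥ c) = 1 := by
    have h3 : (sgn (d ⬝ᵥ a + b ⬝ᵥ c) - 1) • pauliOp a b ψ = 0 := by
      rw [sub_smul, h1, one_smul, sub_self]
    rcases smul_eq_zero.1 h3 with h | h
    · exact sub_eq_zero.1 h
    · exact absurd (pauliOp_injective a b (h.trans (map_zero _).symm)) hψ0
  rw [key, hφ _ hg, h2, one_smul]

end Pauli

/-! ### Joint eigenspaces of the stabilizer of a CSS code -/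

section Translates

variable {ι : Type*} [Fintype ι] [DecidableEq ι]

/-- The translate `X^{t₁} Z^{t₂} C₀` of the CSS code `C₀` of `C`, as the joint eigenspace of the
operators `X^a` and `Z^b`, `a, b ∈ C^⊥`, with eigenvalues `(-1)^{a·t₂}` and `(-1)^{b·t₁}`. -/
def translate (C : Submodule (ZMod 2) (ι → ZMod 2)) (t : (ι → ZMod 2) × (ι → ZMod 2)) :
    Submodule ℂ (Qubits ι) where
  carrier := {ψ | (∀ a ∈ dualCode C, pauliOp a 0 ψ = sgn (a ⬝ᵥ t.2) • ψ) ∧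
    ∀ b ∈ dualCode C, pauliOp 0 b ψ = sgn (b ⬝ᵥ t.1) • ψ}
  add_mem' := by
    intro φ ψ hφ hψ
    refine ⟨fun a ha => ?_, fun b hb => ?_⟩
    · rw [map_add, hφ.1 a ha, hψ.1 a ha, smul_add]
    · rw [map_add, hφ.2 b hb, hψ.2 b hb, smul_add]
  zero_mem' := ⟨fun a _ => by simp, fun b _ => by simp⟩
  smul_mem' := by
    intro r ψ hψ
    refine ⟨fun a ha => ?_, fun b hb => ?_⟩
    · rw [map_smul, hψ.1 a ha, smul_comm]
    · rw [map_smul, hψ.2 b hb, smul_comm]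

variable {C : Submodule (ZMod 2) (ι → ZMod 2)} {t t' : (ι → ZMod 2) × (ι → ZMod 2)}

lemma cssCode_eq_translate : cssCode C C = translate C 0 := by
  ext ψ
  change (_ ∧ _) ↔ (_ ∧ _)
  simp

lemma pauliOp_of_mem_translate {ψ : Qubits ι} (hψ : ψ ∈ translate C t) {a b : ι → ZMod 2}
    (ha : a ∈ dualCode C) (hb : b ∈ dualCode C) :
    pauliOp a b ψ = sgn (a ⬝ᵥ t.2 + b ⬝ᵥ t.1) • ψ := by
  have h := pauliOp_pauliOp a 0 0 b ψ
  rw [hψ.2 b hb, map_smul, hψ.1 a ha, smul_smul, zero_dotProduct, sgn_zero, one_smul, add_zero,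
    zero_add] at h
  rw [← h, sgn_add, mul_comm]

lemma pauliOp_mem_translate {ψ : Qubits ι} (hψ : ψ ∈ translate C t)
    (c : (ι → ZMod 2) × (ι → ZMod 2)) : pauliOp c.1 c.2 ψ ∈ translate C (t + c) := by
  refine ⟨fun a ha => ?_, fun b hb => ?_⟩
  · rw [pauliOp_comm, hψ.1 a ha, map_smul, smul_smul, ← sgn_add, zero_dotProduct, zero_add,
      Prod.snd_add, dotProduct_add, dotProduct_comm c.2, add_comm]
  · rw [pauliOp_comm, hψ.2 b hb, map_smul, smul_smul, ← sgn_add, dotProduct_zero, add_zero,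
      Prod.fst_add, dotProduct_add, add_comm]

/-- The eigenvalues (-1)^(a·t) with a in C^⊥ see t only modulo C. -/
lemma translate_le_of_sub_mem (h : t - t' ∈ C.prod C) : translate C t ≤ translate C t' := by
  have key {a v v' : ι → ZMod 2} (ha : a ∈ dualCode C) (hv : v - v' ∈ C) : a ⬝ᵥ v = a ⬝ᵥ v' := by
    have := ha _ hv
    rwa [dotProduct_sub, sub_eq_zero] at this
  refine fun ψ hψ => ⟨fun a ha => ?_, fun b hb => ?_⟩
  · rw [hψ.1 a ha, key ha h.2]
  · rw [hψ.2 b hb, key hb h.1]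

lemma map_pauliOp_translate (c : (ι → ZMod 2) × (ι → ZMod 2)) :
    (translate C t).map (pauliOp c.1 c.2) = translate C (t + c) := by
  apply le_antisymm
  · rintro _ ⟨ψ, hψ, rfl⟩
    exact pauliOp_mem_translate hψ c
  · intro ψ hψ
    refine ⟨sgn (c.2 ⬝ᵥ c.1) • pauliOp c.1 c.2 ψ, Submodule.smul_mem _ _ ?_, ?_⟩
    · have h := pauliOp_mem_translate hψ c
      have hc : c + c = 0 := by ext i <;> exact CharTwo.add_self_eq_zero _
      rwa [add_assoc, hc, add_zero] at h
    · rw [map_smul, pauliOp_self, smul_smul, sgn_mul_self, one_smul]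

lemma unionCode_cssCode (T : Set ((ι → ZMod 2) × (ι → ZMod 2))) :
    unionCode (cssCode C C) T = ⨆ t ∈ T, translate C t := by
  simp only [unionCode, cssCode_eq_translate, map_pauliOp_translate, zero_add]

lemma inner_eq_zero_of_pauliOp_eq_neg {a b : ι → ZMod 2} {φ ψ : Qubits ι} {z w : ZMod 2}
    (hφ : pauliOp a b φ = sgn z • φ) (hψ : pauliOp a b ψ = sgn w • ψ) (hzw : z ≠ w) :
    inner ℂ φ ψ = 0 := by
  have h := inner_pauliOp_pauliOp a b φ ψ
  rw [hφ, hψ, inner_smul_left, inner_smul_right, conj_sgn, ← mul_assoc, ← sgn_add] at h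
  have h1 : z + w = 1 := by
    rcases zmod_two_eq_zero_or_one z with rfl | rfl <;>
    rcases zmod_two_eq_zero_or_one w with rfl | rfl <;> simp_all
  rw [h1, sgn_one] at h
  linear_combination -h / 2

lemma translate_isOrtho (h : t - t' ∉ C.prod C) : translate C t ⟂ translate C t' := by
  rw [Submodule.isOrtho_iff_inner_eq]
  intro φ hφ ψ hψ
  by_cases h1 : t.1 - t'.1 ∈ C
  · have h2 : t.2 - t'.2 ∉ C := fun h2 => h ⟨h1, h2⟩
    obtain ⟨a, ha, hne⟩ := exists_mem_dualCode_dotProduct_ne_zero h2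
    rw [dotProduct_sub, sub_ne_zero] at hne
    exact inner_eq_zero_of_pauliOp_eq_neg (hφ.1 a ha) (hψ.1 a ha) hne
  · obtain ⟨a, ha, hne⟩ := exists_mem_dualCode_dotProduct_ne_zero h1
    rw [dotProduct_sub, sub_ne_zero] at hne
    exact inner_eq_zero_of_pauliOp_eq_neg (hφ.2 a ha) (hψ.2 a ha) hne

lemma finrank_translate (C : Submodule (ZMod 2) (ι → ZMod 2))
    (t : (ι → ZMod 2) × (ι → ZMod 2)) :
    Module.finrank ℂ (translate C t) = Module.finrank ℂ (cssCode C C) := by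
  rw [← zero_add t, ← map_pauliOp_translate, cssCode_eq_translate]
  exact (LinearEquiv.finrank_eq
    (Submodule.equivMapOfInjective _ (pauliOp_injective t.1 t.2) _)).symm

lemma finrank_iSup_of_iSupIndep {κ V : Type*} [Fintype κ] [AddCommGroup V] [Module ℂ V]
    [FiniteDimensional ℂ V] {p : κ → Submodule ℂ V} (h : iSupIndep p) :
    Module.finrank ℂ (⨆ i, p i : Submodule ℂ V) = ∑ i, Module.finrank ℂ (p i) := by
  classical
  rw [Submodule.iSup_eq_range_dfinsupp_lsum,
    LinearMap.finrank_range_of_inj h.dfinsupp_lsum_injective]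
  exact Module.finrank_directSum ℂ (fun i => p i)

lemma finrank_iSup_translate {T : Set ((ι → ZMod 2) × (ι → ZMod 2))}
    (hT : ∀ t ∈ T, ∀ t' ∈ T, t - t' ∈ C.prod C → t = t') :
    Module.finrank ℂ (⨆ t ∈ T, translate C t : Submodule ℂ (Qubits ι)) =
      T.ncard * Module.finrank ℂ (cssCode C C) := by
  classical
  have hfam : OrthogonalFamily ℂ (fun t : T => translate C t.1)
      fun t => (translate C t.1).subtypeₗᵢ := by
    intro t t' hne φ ψ
    have hne' : t.1 - t'.1 ∉ C.prod C := fun h => hne (Subtype.ext (hT _ t.2 _ t'.2 h))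
    exact Submodule.isOrtho_iff_inner_eq.1 (translate_isOrtho hne') φ φ.2 ψ ψ.2
  rw [iSup_subtype', finrank_iSup_of_iSupIndep hfam.independent]
  simp only [finrank_translate, Finset.sum_const, Finset.card_univ, smul_eq_mul]
  rw [← Nat.card_coe_set_eq, Nat.card_eq_fintype_card]

/-- The Z-conditions confine the support to C = C^⊥⊥, and the X-conditions make ψ constant on cosets
of C^⊥; so the code is the space of functions on C/C^⊥. -/
lemma mem_cssCode_iff {ψ : Qubits ι} : ψ ∈ cssCode C C ↔
    (∀ a ∈ dualCode C, ∀ x, ψ (x + a) = ψ x) ∧ ∀ x, x ∉ C → ψ x = 0 := by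
  refine and_congr ?_ ⟨fun h x hx => ?_, fun h b hb => ?_⟩
  · refine forall₂_congr fun a ha => ?_
    rw [PiLp.ext_iff]
    simp [pauliOp_apply]
  · obtain ⟨b, hb, hne⟩ := exists_mem_dualCode_dotProduct_ne_zero hx
    have h1 : pauliOp 0 b ψ x = ψ x := by rw [h b hb]
    rw [pauliOp_apply, add_zero,
      (zmod_two_eq_zero_or_one _).resolve_left hne, sgn_one] at h1
    linear_combination -h1 / 2
  · ext x
    rw [pauliOp_apply, add_zero]
    by_cases hx : x ∈ C
    · rw [hb x hx, sgn_zero, one_mul]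
    · rw [h x hx, mul_zero]

/-- The dimension of the CSS code of `C` is `|C| / |C^⊥|`. -/
theorem finrank_cssCode_mul (hC : dualCode C ≤ C) :
    Module.finrank ℂ (cssCode C C) * Nat.card (dualCode C) = Nat.card C := by
  classical
  let D : Submodule (ZMod 2) C := (dualCode C).submoduleOf C
  let f : ((C ⧸ D) → ℂ) →ₗ[ℂ] Qubits ι :=
    { toFun := fun g => WithLp.toLp 2 fun x =>
        if h : x ∈ C then g (Submodule.Quotient.mk ⟨x, h⟩) else 0
      map_add' := fun g g' => by
        ext x
        by_cases h : x ∈ C <;> simp [h]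
      map_smul' := fun r g => by
        ext x
        by_cases h : x ∈ C <;> simp [h] }
  have hf1 (g : (C ⧸ D) → ℂ) (x : ι → ZMod 2) (h : x ∈ C) :
      f g x = g (Submodule.Quotient.mk ⟨x, h⟩) := dif_pos h
  have hf0 (g : (C ⧸ D) → ℂ) (x : ι → ZMod 2) (h : x ∉ C) : f g x = 0 := dif_neg h
  have hinj : Function.Injective f := by
    intro g g' hgg
    ext q
    obtain ⟨⟨x, hx⟩, rfl⟩ := Submodule.Quotient.mk_surjective _ q
    rw [← hf1 g x hx, hgg, hf1]
  have hrange : LinearMap.range f = cssCode C C := by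
    ext ψ
    rw [mem_cssCode_iff]
    constructor
    · rintro ⟨g, rfl⟩
      refine ⟨fun a ha x => ?_, fun x hx => hf0 g x hx⟩
      by_cases hx : x ∈ C
      · rw [hf1 g _ (C.add_mem hx (hC ha)), hf1 g x hx]
        congr 1
        rw [Submodule.Quotient.eq]
        change x + a - x ∈ dualCode C
        simpa using ha
      · rw [hf0 g x hx, hf0 g]
        intro h
        exact hx (by simpa using C.sub_mem h (hC ha))
    · rintro ⟨h1, h2⟩
      refine ⟨fun q => ψ (q.out : C), ?_⟩
      ext x
      by_cases hx : x ∈ C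
      · rw [hf1 _ x hx]
        have h3 : Submodule.Quotient.mk (p := D)
            (Quotient.out (Submodule.Quotient.mk (p := D) ⟨x, hx⟩)) =
            Submodule.Quotient.mk ⟨x, hx⟩ := Quotient.out_eq _
        rw [Submodule.Quotient.eq] at h3
        have h4 := h1 _ h3 x
        simpa using h4
      · rw [hf0 _ x hx, h2 x hx]
  have hD : Nat.card D = Nat.card (dualCode C) :=
    Nat.card_congr (Submodule.submoduleOfEquivOfLe hC).toEquiv
  rw [← hrange, LinearMap.finrank_range_of_inj hinj, Module.finrank_fintype_fun_eq_card,
    ← Nat.card_eq_fintype_card, ← hD, mul_comm, D.card_eq_card_quotient_mul_card]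

lemma finrank_cssCode_pos (hC : dualCode C ≤ C) : 0 < Module.finrank ℂ (cssCode C C) := by
  have h := finrank_cssCode_mul hC
  have h2 : 0 < Nat.card C := Nat.card_pos
  rw [← h] at h2
  exact pos_of_mul_pos_left h2 (Nat.zero_le _)

lemma exists_mem_translate_ne_zero (hC : dualCode C ≤ C) (t : (ι → ZMod 2) × (ι → ZMod 2)) :
    ∃ ψ ∈ translate C t, ψ ≠ 0 := by
  have h := finrank_cssCode_pos hC
  rw [← finrank_translate C t, Module.finrank_pos_iff] at h
  obtain ⟨ψ, hψ⟩ := exists_ne (0 : translate C t)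
  exact ⟨ψ, ψ.2, fun h => hψ (Subtype.ext h)⟩

/-- The translates of a CSS code span the whole space. -/
theorem iSup_translate_eq_top (hC : dualCode C ≤ C) :
    (⨆ t, translate C t : Submodule ℂ (Qubits ι)) = ⊤ := by
  classical
  -- C has |C^⊥| cosets, so the orthogonal translates have total dimension |C^⊥|² · |C|/|C^⊥| =
  -- |C^⊥| |C|, that of the whole space.
  obtain ⟨T, hT⟩ := exists_isCosetDecomposition (C := C) (S := Set.univ) (by simp)
  have hle : (⨆ t ∈ ((T ×ˢ T : Finset _) : Set ((ι → ZMod 2) × (ι → ZMod 2))), translate C t) ≤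
      ⨆ t, translate C t := iSup₂_le fun t _ => le_iSup (translate C) t
  refine top_le_iff.1 (le_trans (top_le_iff.2 ?_) hle)
  apply Submodule.eq_top_of_finrank_eq
  rw [finrank_iSup_translate, Set.ncard_coe_finset, Finset.card_product, finrank_euclideanSpace]
  · have h1 := hT.card_mul
    have h2 := finrank_cssCode_mul hC
    have h3 : Nat.card C * Nat.card (dualCode C) = Fintype.card (ι → ZMod 2) := by
      rw [card_submodule_eq, card_submodule_eq, ← pow_add, finrank_add_finrank_dualCode,
        Fintype.card_fun, ZMod.card]
    rw [Set.ncard_univ, Nat.card_eq_fintype_card (α := ι → ZMod 2)] at h1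
    have hpos : 0 < Nat.card C := Nat.card_pos
    have h4 : T.card = Nat.card (dualCode C) := by
      apply Nat.eq_of_mul_eq_mul_right hpos
      rw [h1, ← h3, mul_comm]
    rw [← h1, ← h2, h4]
    ring
  · intro t ht t' ht' h
    rw [Finset.mem_coe, Finset.mem_product] at ht ht'
    exact Prod.ext (hT.2 _ ht.1 _ ht'.1 h.1) (hT.2 _ ht.2 _ ht'.2 h.2)

/-! ### Errors on union codes -/

variable {T : Set ((ι → ZMod 2) × (ι → ZMod 2))}

/-- The error maps the code into its orthogonal complement, so its compression is 0. -/
lemma detects_of_forall_notMem {c : (ι → ZMod 2) × (ι → ZMod 2)}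
    (h : ∀ t ∈ T, ∀ t' ∈ T, t' + c - t ∉ C.prod C) :
    Detects (⨆ t ∈ T, translate C t) (pauliOp c.1 c.2) := by
  have hortho : (⨆ t ∈ T, translate C t : Submodule ℂ (Qubits ι)) ⟂
      (⨆ t ∈ T, translate C t).map (pauliOp c.1 c.2) := by
    simp only [Submodule.map_iSup, map_pauliOp_translate, Submodule.isOrtho_iSup_left,
      Submodule.isOrtho_iSup_right]
    exact fun t ht t' ht' => (translate_isOrtho (h t' ht' t ht)).symm
  refine ⟨0, fun φ hφ ψ hψ => ?_⟩
  rw [zero_mul]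
  exact Submodule.isOrtho_iff_inner_eq.1 hortho φ hφ _ ⟨ψ, hψ, rfl⟩

lemma detects_one (Q : Submodule ℂ (Qubits ι)) : Detects Q (pauliOp 0 0) :=
  ⟨1, fun φ _ ψ _ => by rw [pauliOp_zero_zero, one_mul]⟩

/-- For nonzero ψ in the component of t, Eψ lies in the orthogonal component of t'. Then ⟨Eψ|E|ψ⟩ ≠
0 although ⟨Eψ|ψ⟩ = 0. -/
lemma not_detects_of_mem (hC : dualCode C ≤ C) {c : (ι → ZMod 2) × (ι → ZMod 2)} (ht : t ∈ T)
    (ht' : t' ∈ T) (hne : t - t' ∉ C.prod C) (hc : t + c - t' ∈ C.prod C) :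
    ¬ Detects (⨆ t ∈ T, translate C t) (pauliOp c.1 c.2) := by
  rintro ⟨z, hz⟩
  obtain ⟨ψ, hψ, hψ0⟩ := exists_mem_translate_ne_zero hC t
  have hE : pauliOp c.1 c.2 ψ ∈ translate C t' :=
    translate_le_of_sub_mem hc (pauliOp_mem_translate hψ c)
  have hle {t} (ht : t ∈ T) : translate C t ≤ ⨆ t ∈ T, translate C t :=
    le_iSup₂ (f := fun t _ => translate C t) t ht
  have h1 := hz _ (hle ht' hE) ψ (hle ht hψ)
  rw [inner_pauliOp_pauliOp,
    Submodule.isOrtho_iff_inner_eq.1 (translate_isOrtho hne).symm _ hE ψ hψ, mul_zero] at h1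
  exact hψ0 (inner_self_eq_zero.1 h1)

/-- The translations of a union code that is a stabilizer code are closed under addition modulo
`C × C`. -/
lemma exists_add_sub_mem_of_isStabilizerCode (hC : dualCode C ≤ C)
    (hQ : IsStabilizerCode (⨆ t ∈ T, translate C t)) {c c' : (ι → ZMod 2) × (ι → ZMod 2)}
    (h0 : ∃ t ∈ T, 0 - t ∈ C.prod C) (hc : ∃ t ∈ T, c - t ∈ C.prod C)
    (hc' : ∃ t ∈ T, c' - t ∈ C.prod C) : ∃ t ∈ T, c + c' - t ∈ C.prod C := by
  have hle {v} (hv : ∃ t ∈ T, v - t ∈ C.prod C) : translate C v ≤ ⨆ t ∈ T, translate C t := by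
    obtain ⟨t, ht, hvt⟩ := hv
    exact (translate_le_of_sub_mem hvt).trans (le_iSup₂ (f := fun t _ => translate C t) t ht)
  obtain ⟨ψ, hψ, hψ0⟩ := exists_mem_translate_ne_zero hC (0 : (ι → ZMod 2) × (ι → ZMod 2))
  have hE := pauliOp_mem_translate hψ c
  rw [zero_add] at hE
  obtain ⟨φ, hφ, hφ0⟩ := exists_mem_translate_ne_zero hC c'
  -- The Pauli operator of c takes a nonzero vector of the component of 0 into the code, so it
  -- preserves the code; applied to the component of c', it lands in that of c + c'.
  have hmem := hQ.pauliOp_mem (hle h0 hψ) hψ0 (hle hc hE) (hle hc' hφ)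
  have hφE := pauliOp_mem_translate hφ c
  rw [add_comm] at hφE
  by_contra! hnot
  have hortho : translate C (c + c') ⟂ ⨆ t ∈ T, translate C t := by
    simp only [Submodule.isOrtho_iSup_right]
    exact fun t ht => translate_isOrtho (hnot t ht)
  have h1 := Submodule.isOrtho_iff_inner_eq.1 hortho _ hφE _ hmem
  rw [inner_pauliOp_pauliOp] at h1
  exact hφ0 (inner_self_eq_zero.1 h1)

/-- A union code whose translations form a linear space modulo `C × C` is a stabilizer code. -/
theorem isStabilizerCode_iSup_translate (hC : dualCode C ≤ C)
    {L : Submodule (ZMod 2) ((ι → ZMod 2) × (ι → ZMod 2))} (hTL : ∀ t ∈ T, t ∈ L)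
    (hCL : C.prod C ≤ L) (hLT : ∀ l ∈ L, ∃ t ∈ T, l - t ∈ C.prod C) :
    IsStabilizerCode (⨆ t ∈ T, translate C t) := by
  set Q : Submodule ℂ (Qubits ι) := ⨆ t ∈ T, translate C t with hQ
  have hle {v} (hv : v ∈ L) : translate C v ≤ Q := by
    obtain ⟨t, ht, hvt⟩ := hLT v hv
    exact (translate_le_of_sub_mem hvt).trans (le_iSup₂ (f := fun t _ => translate C t) t ht)
  -- The stabilizer is the symplectic annihilator of L; it is commutative because C^⊥ is contained
  -- in C.
  refine ⟨?_, {g | ∃ a ∈ dualCode C, ∃ b ∈ dualCode C,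
    (∀ l ∈ L, a ⬝ᵥ l.2 + b ⬝ᵥ l.1 = 0) ∧ g = pauliOp a b}, ?_, ?_, ?_⟩
  · intro h
    obtain ⟨ψ, hψ, hψ0⟩ := exists_mem_translate_ne_zero hC (0 : (ι → ZMod 2) × (ι → ZMod 2))
    have := hle L.zero_mem hψ
    rw [h] at this
    exact hψ0 ((Submodule.mem_bot ℂ).1 this)
  · rintro _ ⟨a, -, b, -, -, rfl⟩
    exact ⟨0, a, b, by simp⟩
  · rintro _ ⟨a, ha, b, hb, -, rfl⟩ _ ⟨c, hc, d, hd, -, rfl⟩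
    refine LinearMap.ext fun ψ => ?_
    rw [Module.End.mul_apply, Module.End.mul_apply, pauliOp_comm, hb c (hC hc), hd a (hC ha),
      add_zero, sgn_zero, one_smul]
  · have hfix (φ : Qubits ι) (hφ : φ ∈ Q) {a b : ι → ZMod 2} (ha : a ∈ dualCode C)
        (hb : b ∈ dualCode C) (hab : ∀ l ∈ L, a ⬝ᵥ l.2 + b ⬝ᵥ l.1 = 0) : pauliOp a b φ = φ := by
      have hQle : Q ≤ LinearMap.eqLocus (pauliOp a b) LinearMap.id := by
        refine iSup₂_le fun t ht ψ hψ => ?_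
        rw [LinearMap.mem_eqLocus, pauliOp_of_mem_translate hψ ha hb, hab t (hTL t ht), sgn_zero,
          one_smul, LinearMap.id_apply]
      exact hQle hφ
    intro ψ
    constructor
    · rintro hψ _ ⟨a, ha, b, hb, hab, rfl⟩
      exact hfix ψ hψ ha hb hab
    · intro hψ
      obtain ⟨y, hy, z, hz, rfl⟩ := Q.exists_add_mem_mem_orthogonal ψ
      have hzfix {a b : ι → ZMod 2} (ha : a ∈ dualCode C) (hb : b ∈ dualCode C)
          (hab : ∀ l ∈ L, a ⬝ᵥ l.2 + b ⬝ᵥ l.1 = 0) : pauliOp a b z = z := by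
        have h := hψ _ ⟨a, ha, b, hb, hab, rfl⟩
        rw [map_add, hfix y hy ha hb hab] at h
        exact add_left_cancel h
      -- The part z orthogonal to Q is also fixed by the stabilizer. For t outside L, a functional
      -- vanishing on L but not at t yields a stabilizer element acting as -1 on that translate; so
      -- z is orthogonal to every translate.
      have hortho : (⨆ t, translate C t : Submodule ℂ (Qubits ι)) ⟂ Submodule.span ℂ {z} := by
        rw [Submodule.isOrtho_iSup_left]
        intro t
        rw [Submodule.isOrtho_iff_inner_eq]
        intro φ hφ v hv
        obtain ⟨r, rfl⟩ := Submodule.mem_span_singleton.1 hv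
        rw [inner_smul_right]
        refine mul_eq_zero_of_right _ ?_
        by_cases ht : t ∈ L
        · exact (Submodule.mem_orthogonal _ _).1 hz φ (hle ht hφ)
        · obtain ⟨f, hft, hf⟩ := Submodule.exists_le_ker_of_notMem ht
          obtain ⟨b, hb⟩ := (dotProductEquiv (ZMod 2) ι).surjective
            (f ∘ₗ LinearMap.inl (ZMod 2) _ _)
          obtain ⟨a, ha⟩ := (dotProductEquiv (ZMod 2) ι).surjective
            (f ∘ₗ LinearMap.inr (ZMod 2) _ _)
          have hb' (v : ι → ZMod 2) : b ⬝ᵥ v = f (v, 0) := LinearMap.congr_fun hb v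
          have ha' (v : ι → ZMod 2) : a ⬝ᵥ v = f (0, v) := LinearMap.congr_fun ha v
          have hab (l : (ι → ZMod 2) × (ι → ZMod 2)) : a ⬝ᵥ l.2 + b ⬝ᵥ l.1 = f l := by
            rw [ha', hb', ← map_add]
            simp
          have haC : a ∈ dualCode C := fun v hv => by
            rw [ha']
            exact hf (hCL ⟨C.zero_mem, hv⟩)
          have hbC : b ∈ dualCode C := fun v hv => by
            rw [hb']
            exact hf (hCL ⟨hv, C.zero_mem⟩)
          refine inner_eq_zero_of_pauliOp_eq_neg (pauliOp_of_mem_translate hφ haC hbC)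
            (w := 0) ?_ (by rwa [hab])
          rw [sgn_zero, one_smul]
          exact hzfix haC hbC fun l hl => by rw [hab]; exact hf hl
      rw [iSup_translate_eq_top hC, Submodule.isOrtho_top_left,
        Submodule.span_singleton_eq_bot] at hortho
      rw [hortho, add_zero]
      exact hy

end Translates

/-! ### The minimum distance of Reed-Muller codes -/

section MinDistance

variable {m : ℕ}

/-- A nonempty set of points over which all polynomials of degree at most `r` sum to zero has at
least `2^(r+1)` points. -/
lemma two_pow_le_card_of_sum_eval_eq_zero (r : ℕ) (S : Finset (Fin m → ZMod 2)) (hS : S.Nonempty)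
    (h : ∀ g : MvPolynomial (Fin m) (ZMod 2), g.totalDegree ≤ r →
      ∑ p ∈ S, MvPolynomial.eval p g = 0) : 2 ^ (r + 1) ≤ S.card := by
  classical
  induction r generalizing S with
  | zero =>
    have h1 := h 1 (by simp)
    simp only [map_one, Finset.sum_const, nsmul_eq_mul, mul_one] at h1
    obtain ⟨k, hk⟩ := (ZMod.natCast_eq_zero_iff_even).1 h1
    have := hS.card_pos
    omega
  | succ r ih =>
    have h2 : 2 ^ (r + 1) ≤ S.card := ih S hS fun g hg => h g (by omega)
    have h3 : 1 < S.card := lt_of_lt_of_le (Nat.one_lt_two_pow (by omega)) h2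
    obtain ⟨p, hp, p', hp', hne⟩ := Finset.one_lt_card.1 h3
    obtain ⟨i, hi⟩ := Function.ne_iff.1 hne
    -- The points p, p' differ at i, so both slices of S along i are nonempty. The indicator of a
    -- slice is the degree-one polynomial x_i + a + 1, so each slice satisfies the hypothesis for r.
    have hhalf (a : ZMod 2) : ∀ g : MvPolynomial (Fin m) (ZMod 2), g.totalDegree ≤ r →
        ∑ p ∈ S with p i = a, MvPolynomial.eval p g = 0 := by
      intro g hg
      have hdeg : (MvPolynomial.X i + MvPolynomial.C (a + 1) :
          MvPolynomial (Fin m) (ZMod 2)).totalDegree ≤ 1 :=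
        (MvPolynomial.totalDegree_add _ _).trans
          (by rw [MvPolynomial.totalDegree_C, MvPolynomial.totalDegree_X]; rfl)
      have h4 := h (g * (MvPolynomial.X i + MvPolynomial.C (a + 1)))
        ((MvPolynomial.totalDegree_mul _ _).trans (by omega))
      rw [← h4, Finset.sum_filter]
      refine Finset.sum_congr rfl fun p _ => ?_
      simp only [map_mul, map_add, MvPolynomial.eval_X, MvPolynomial.eval_C]
      have hite : ∀ x a z : ZMod 2, (if x = a then z else 0) = z * (x + (a + 1)) := by decide
      exact hite _ _ _
    have hcard : ∀ q ∈ S, 2 ^ (r + 1) ≤ (S.filter fun p => p i = q i).card := fun q hq =>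
      ih _ ⟨q, by simp [hq]⟩ (hhalf (q i))
    have hdisj : Disjoint (S.filter fun x => x i = p i) (S.filter fun x => x i = p' i) := by
      rw [Finset.disjoint_filter]
      exact fun x _ h1 h2 => hi (h1.symm.trans h2)
    calc 2 ^ (r + 1 + 1) = 2 ^ (r + 1) + 2 ^ (r + 1) := by ring
      _ ≤ _ := Nat.add_le_add (hcard p hp) (hcard p' hp')
      _ = _ := (Finset.card_union_of_disjoint hdisj).symm
      _ ≤ S.card := Finset.card_le_card
        (Finset.union_subset (Finset.filter_subset _ _) (Finset.filter_subset _ _))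

/-- The support of f qualifies for the previous bound, because f is orthogonal to RM(r,m). -/
theorem two_pow_le_hammingNorm_of_mem_reedMuller {k r : ℕ} (hkr : k + r < m)
    {f : (Fin m → ZMod 2) → ZMod 2} (hf : f ∈ reedMuller k m) (hf0 : f ≠ 0) :
    2 ^ (r + 1) ≤ hammingNorm f := by
  refine two_pow_le_card_of_sum_eval_eq_zero r _ ?_ fun g hg => ?_
  · rw [Finset.nonempty_iff_ne_empty]
    intro h
    exact hf0 (hammingNorm_eq_zero.1 (Finset.card_eq_zero.2 h))
  · have hg' : MvPolynomial.evalₗ (ZMod 2) (Fin m) g ∈ reedMuller r m :=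
      ⟨g, (MvPolynomial.mem_restrictTotalDegree _ _ _).2 hg, rfl⟩
    rw [← reedMuller_dotProduct_eq_zero hkr hf hg', dotProduct]
    exact (sum_smul_eq_sum_support f _).symm

end MinDistance

/-! ### Weights of Pauli operators -/

section Weights

variable {ι : Type*}

lemma add_self_eq_zero_fun (v : ι → ZMod 2) : v + v = 0 := by
  ext i
  exact CharTwo.add_self_eq_zero _

variable [Fintype ι]

lemma hammingNorm_fst_le_pauliWeight (a b : ι → ZMod 2) : hammingNorm a ≤ pauliWeight a b :=
  Finset.card_le_card fun i hi => by
    simp only [Finset.mem_filter, Finset.mem_univ, true_and] at hi ⊢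
    exact fun h => hi (congrArg Prod.fst h)

lemma hammingNorm_snd_le_pauliWeight (a b : ι → ZMod 2) : hammingNorm b ≤ pauliWeight a b :=
  Finset.card_le_card fun i hi => by
    simp only [Finset.mem_filter, Finset.mem_univ, true_and] at hi ⊢
    exact fun h => hi (congrArg Prod.snd h)

lemma pauliWeight_zero_right (a : ι → ZMod 2) : pauliWeight a 0 = hammingNorm a := by
  simp only [pauliWeight, hammingNorm, Pi.zero_apply, ne_eq, Prod.mk_eq_zero, and_true]

/-- Where (a_i, b_i) ≠ (0,0), exactly two of a_i, b_i, a_i + b_i are nonzero. -/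
lemma hammingNorm_add_add (a b : ι → ZMod 2) :
    hammingNorm a + hammingNorm b + hammingNorm (a + b) = 2 * pauliWeight a b := by
  rw [pauliWeight, hammingNorm, hammingNorm, hammingNorm, hammingNorm, Finset.card_filter,
    Finset.card_filter, Finset.card_filter, Finset.card_filter, Finset.mul_sum,
    ← Finset.sum_add_distrib, ← Finset.sum_add_distrib]
  refine Finset.sum_congr rfl fun i _ => ?_
  rw [Pi.add_apply]
  rcases zmod_two_eq_zero_or_one (a i) with h | h <;>
  rcases zmod_two_eq_zero_or_one (b i) with h' | h' <;>
  simp [h, h', CharTwo.add_self_eq_zero]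

end Weights

/-! ### CSS-like union codes from codes invariant under `C` -/

section CssUnion

variable {ι : Type*} [Fintype ι] [DecidableEq ι] {C : Submodule (ZMod 2) (ι → ZMod 2)}
  {P : Set (ι → ZMod 2)} {T₁ T₂ : Finset (ι → ZMod 2)}

lemma cssUnionCode_eq (C : Submodule (ZMod 2) (ι → ZMod 2)) (T₁ T₂ : Finset (ι → ZMod 2)) :
    cssUnionCode C C T₁ T₂ = ⨆ t ∈ {t | t.1 ∈ T₁ ∧ t.2 ∈ T₂}, translate C t :=
  unionCode_cssCode _

lemma finrank_cssUnionCode (h₁ : IsCosetDecomposition C T₁ P) (h₂ : IsCosetDecomposition C T₂ P) :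
    Module.finrank ℂ (cssUnionCode C C T₁ T₂) =
      T₁.card * T₂.card * Module.finrank ℂ (cssCode C C) := by
  have hT : {t : (ι → ZMod 2) × (ι → ZMod 2) | t.1 ∈ T₁ ∧ t.2 ∈ T₂} =
      ((T₁ ×ˢ T₂ : Finset _) : Set ((ι → ZMod 2) × (ι → ZMod 2))) := by
    ext t
    simp
  rw [cssUnionCode_eq, finrank_iSup_translate, hT, Set.ncard_coe_finset, Finset.card_product]
  rintro t ⟨ht1, ht2⟩ u ⟨hu1, hu2⟩ h
  exact Prod.ext (h₁.2 _ ht1 _ hu1 h.1) (h₂.2 _ ht2 _ hu2 h.2)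

/-- The minimum distance of a CSS-like union code is that of the classical code, if the latter is
attained by a word outside `C`. -/
lemma isLeast_undetectedWeights_cssUnionCode (hC : dualCode C ≤ C) {d : ℕ}
    (h₁ : IsCosetDecomposition C T₁ P) (h₂ : IsCosetDecomposition C T₂ P)
    (hd : ∀ c ∈ P, ∀ c' ∈ P, c + c' ≠ 0 → d ≤ hammingNorm (c + c')) (h0 : 0 ∈ P)
    {c : ι → ZMod 2} (hc : c ∈ P) (hcC : c ∉ C) (hcd : hammingNorm c = d) :
    IsLeast (undetectedWeights (cssUnionCode C C T₁ T₂)) d := by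
  rw [cssUnionCode_eq]
  constructor
  · obtain ⟨t₀, ht₀, h0t⟩ := (h₁.1 0).1 h0
    obtain ⟨t₁, ht₁, hct⟩ := (h₁.1 c).1 hc
    obtain ⟨u, hu, -⟩ := (h₂.1 0).1 h0
    refine ⟨c, 0, by rw [pauliWeight_zero_right, hcd], ?_⟩
    -- The bit-flip error X^c joins the classes of 0 and c, which differ because c is outside C.
    refine not_detects_of_mem hC (c := (c, 0)) (t := (t₀, u)) (t' := (t₁, u)) ⟨ht₀, hu⟩ ⟨ht₁, hu⟩
      (fun h => hcC ?_) ⟨?_, ?_⟩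
    · have h3 := C.sub_mem (C.sub_mem hct h.1) h0t
      simpa using h3
    · have h3 := C.sub_mem hct h0t
      have h4 : t₀ + c - t₁ = c - t₁ - (0 - t₀) := by abel
      change t₀ + c - t₁ ∈ C
      rwa [h4]
    · simp
  · rintro w ⟨a, b, rfl, hdet⟩
    by_contra hlt
    rw [not_le] at hlt
    -- If t' + a is congruent to t, then t' + a and t' are both words of P, at distance the weight
    -- of a, which is below d.
    have hclose {T : Finset (ι → ZMod 2)} (h : IsCosetDecomposition C T P) {t t' a : ι → ZMod 2}
        (ht : t ∈ T) (ht' : t' ∈ T) (hat : t' + a - t ∈ C) (ha : hammingNorm a < d) : a = 0 := by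
      by_contra ha0
      have hmem (t : ι → ZMod 2) (ht : t ∈ T) : t ∈ P := (h.1 t).2 ⟨t, ht, by simp⟩
      have h1 : t' + a ∈ P := (h.1 _).2 ⟨t, ht, hat⟩
      have h2 : t' + a + t' = a := by
        rw [add_right_comm, add_self_eq_zero_fun, zero_add]
      have h3 := hd _ h1 _ (hmem t' ht')
      rw [h2] at h3
      exact absurd (h3 ha0) (not_le.2 ha)
    apply hdet
    by_cases hab : a = 0 ∧ b = 0
    · rw [hab.1, hab.2]
      exact detects_one _
    · refine detects_of_forall_notMem (c := (a, b)) ?_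
      rintro t ⟨ht1, ht2⟩ t' ⟨ht1', ht2'⟩ h
      exact hab ⟨hclose h₁ ht1 ht1' h.1 ((hammingNorm_fst_le_pauliWeight a b).trans_lt hlt),
        hclose h₂ ht2 ht2' h.2 ((hammingNorm_snd_le_pauliWeight a b).trans_lt hlt)⟩

/-- A CSS-like union code from a nonlinear code is not a stabilizer code. -/
lemma not_isStabilizerCode_cssUnionCode (hC : dualCode C ≤ C)
    (h₁ : IsCosetDecomposition C T₁ P) (h₂ : IsCosetDecomposition C T₂ P) (h0 : 0 ∈ P)
    {c c' : ι → ZMod 2} (hc : c ∈ P) (hc' : c' ∈ P) (hcc' : c + c' ∉ P) :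
    ¬ IsStabilizerCode (cssUnionCode C C T₁ T₂) := by
  rw [cssUnionCode_eq]
  intro hQ
  have key {v : ι → ZMod 2} (hv : v ∈ P) :
      ∃ t ∈ {t : (ι → ZMod 2) × (ι → ZMod 2) | t.1 ∈ T₁ ∧ t.2 ∈ T₂}, (v, 0) - t ∈ C.prod C := by
    obtain ⟨t, ht, hvt⟩ := (h₁.1 v).1 hv
    obtain ⟨u, hu, hu0⟩ := (h₂.1 0).1 h0
    exact ⟨(t, u), ⟨ht, hu⟩, hvt, hu0⟩
  obtain ⟨t, ht, h⟩ := exists_add_sub_mem_of_isStabilizerCode hC hQ (key h0) (key hc) (key hc')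
  exact hcc' ((h₁.1 _).2 ⟨t.1, ht.1, h.1⟩)

end CssUnion

/-! ### Enlarged CSS codes -/

section Enlarged

variable {ι : Type*} {C C' D : Submodule (ZMod 2) (ι → ZMod 2)} {A : D ≃ₗ[ZMod 2] D}

lemma IsEnlargementData.eq_zero_of_mem (h : IsEnlargementData C C' D A) {v : D}
    (hv : (v : ι → ZMod 2) ∈ C) : v = 0 := by
  have h1 : (v : ι → ZMod 2) ∈ C ⊓ D := ⟨hv, v.2⟩
  rw [h.1] at h1
  exact Subtype.ext ((Submodule.mem_bot _).1 h1)

variable [Fintype ι]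

lemma IsEnlargementData.finrank_add (h : IsEnlargementData C C' D A) :
    Module.finrank (ZMod 2) C + Module.finrank (ZMod 2) D = Module.finrank (ZMod 2) C' := by
  have h1 := Submodule.finrank_sup_add_finrank_inf_eq C D
  rw [h.1, h.2.1, finrank_bot, add_zero] at h1
  exact h1.symm

variable [DecidableEq ι]

lemma enlargedCode_eq (C D : Submodule (ZMod 2) (ι → ZMod 2)) (A : D ≃ₗ[ZMod 2] D) :
    enlargedCode C D A =
      ⨆ t ∈ {t | ∃ v : D, t = ((v : ι → ZMod 2), (A v : ι → ZMod 2))}, translate C t :=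
  unionCode_cssCode _

lemma isStabilizerCode_enlargedCode (hC : dualCode C ≤ C) :
    IsStabilizerCode (enlargedCode C D A) := by
  rw [enlargedCode_eq]
  let g : D →ₗ[ZMod 2] (ι → ZMod 2) × (ι → ZMod 2) :=
    D.subtype.prod (D.subtype ∘ₗ A.toLinearMap)
  refine isStabilizerCode_iSup_translate hC (L := C.prod C ⊔ LinearMap.range g) ?_ le_sup_left ?_
  · rintro _ ⟨v, rfl⟩
    exact Submodule.mem_sup_right ⟨v, rfl⟩
  · intro l hl
    obtain ⟨y, hy, _, ⟨v, rfl⟩, rfl⟩ := Submodule.mem_sup.1 hl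
    refine ⟨g v, ⟨v, rfl⟩, ?_⟩
    rwa [add_sub_cancel_right]

lemma finrank_enlargedCode (h : IsEnlargementData C C' D A) :
    Module.finrank ℂ (enlargedCode C D A) =
      2 ^ Module.finrank (ZMod 2) D * Module.finrank ℂ (cssCode C C) := by
  rw [enlargedCode_eq, finrank_iSup_translate]
  · have hinj : Function.Injective
        (fun v : D => ((v : ι → ZMod 2), (A v : ι → ZMod 2))) := fun v v' hvv' =>
      Subtype.ext (congrArg Prod.fst hvv')
    have hT : {t | ∃ v : D, t = ((v : ι → ZMod 2), (A v : ι → ZMod 2))} =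
        Set.range (fun v : D => ((v : ι → ZMod 2), (A v : ι → ZMod 2))) := by
      ext t
      exact exists_congr fun v => eq_comm
    rw [hT, ← Nat.card_coe_set_eq, Nat.card_range_of_injective hinj, card_submodule_eq]
  · rintro _ ⟨v, rfl⟩ _ ⟨v', rfl⟩ hvv'
    have h1 : v - v' = 0 := h.eq_zero_of_mem hvv'.1
    rw [sub_eq_zero.1 h1]

/-- If `C` has minimum distance at least `6` and `C'` at least `4`, then the enlarged code detects
all errors of weight less than `6`. -/
lemma six_le_of_mem_undetectedWeights_enlargedCode (h : IsEnlargementData C C' D A)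
    (hd : ∀ c ∈ C, c ≠ 0 → 6 ≤ hammingNorm c) (hd' : ∀ c ∈ C', c ≠ 0 → 4 ≤ hammingNorm c) :
    ∀ w ∈ undetectedWeights (enlargedCode C D A), 6 ≤ w := by
  rw [enlargedCode_eq]
  rintro w ⟨a, b, rfl, hdet⟩
  by_contra hlt
  rw [not_le] at hlt
  apply hdet
  by_cases hab : a = 0 ∧ b = 0
  · rw [hab.1, hab.2]
    exact detects_one _
  refine detects_of_forall_notMem (c := (a, b)) ?_
  rintro _ ⟨v, rfl⟩ _ ⟨v', rfl⟩ ⟨h1, h2⟩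
  set u : D := v - v' with hu
  have ha : a - u ∈ C := by
    have h3 : a - (u : ι → ZMod 2) = v' + a - v := by
      rw [hu, Submodule.coe_sub]
      abel
    rw [h3]
    exact h1
  have hb : b - A u ∈ C := by
    have h3 : b - (A u : ι → ZMod 2) = A v' + b - A v := by
      rw [hu, map_sub, Submodule.coe_sub]
      abel
    rw [h3]
    exact h2
  have hawt := (hammingNorm_fst_le_pauliWeight a b).trans_lt hlt
  have hbwt := (hammingNorm_snd_le_pauliWeight a b).trans_lt hlt
  by_cases hu0 : u = 0
  · rw [hu0, Submodule.coe_zero, sub_zero] at ha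
    rw [hu0, map_zero, Submodule.coe_zero, sub_zero] at hb
    refine hab ⟨?_, ?_⟩
    · by_contra ha0
      exact absurd (hd a ha ha0) (not_le.2 hawt)
    · by_contra hb0
      exact absurd (hd b hb hb0) (not_le.2 hbwt)
  -- Now a, b, a + b lie in C' in the classes of u, Au, u + Au modulo C. All three are nonzero, the
  -- last since A has no nonzero fixed point, so twice the Pauli weight is at least 12.
  · have key {x : ι → ZMod 2} {v : D} (hx : x - v ∈ C) (hv : v ≠ 0) : 4 ≤ hammingNorm x := by
      refine hd' x ?_ ?_
      · rw [← h.2.1, ← sub_add_cancel x (v : ι → ZMod 2)]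
        exact Submodule.add_mem_sup hx v.2
      · rintro rfl
        rw [zero_sub, neg_mem_iff] at hx
        exact hv (h.eq_zero_of_mem hx)
    have hab' : a + b - ((u + A u : D) : ι → ZMod 2) ∈ C := by
      have := C.add_mem ha hb
      rwa [sub_add_sub_comm] at this
    have hne : u + A u ≠ 0 := by
      intro h0
      refine hu0 (h.2.2 u ?_)
      have huu : u + u = 0 := Subtype.ext (add_self_eq_zero_fun (u : ι → ZMod 2))
      exact add_left_cancel (h0.trans huu.symm)
    have w1 := key ha hu0
    have w2 := key hb (fun h0 => hu0 ((LinearEquiv.map_eq_zero_iff A).1 h0))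
    have w3 := key hab' hne
    have w4 := hammingNorm_add_add a b
    omega

end Enlarged

end UnionCode

theorem mainTheorem4 (m : ℕ) (hm : 6 ≤ m) (hm2 : Even m)
    {F : Type*} [Field F] [Fintype F] [Algebra (ZMod 2) F] (hF : Fintype.card F = 2 ^ (m - 1))
    (e : (Fin m → ZMod 2) ≃ₗ[ZMod 2] F × ZMod 2) (s : ℕ) (hs : Nat.Coprime s (m - 1)) :
    -- the Preparata code is a union of `K_P` cosets of `RM(m - 3, m)`
    (∃ T, IsCosetDecomposition (reedMuller (m - 3) m) T (preparata e s)) ∧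
    (∀ T, IsCosetDecomposition (reedMuller (m - 3) m) T (preparata e s) →
      T.card = 2 ^ (m.choose 2 - m + 1)) ∧
    -- the CSS construction applies to `RM(m - 3, m)`
    dualCode (reedMuller (m - 3) m) ≤ reedMuller (m - 3) m ∧
    -- the CSS-like union codes
    ∀ T₁ T₂ : Finset ((Fin m → ZMod 2) → ZMod 2),
      IsCosetDecomposition (reedMuller (m - 3) m) T₁ (preparata e s) →
      IsCosetDecomposition (reedMuller (m - 3) m) T₂ (preparata e s) →
      ∀ Q : Submodule ℂ (Qubits (Fin m → ZMod 2)),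
        Q = cssUnionCode (reedMuller (m - 3) m) (reedMuller (m - 3) m) T₁ T₂ →
        Module.finrank ℂ Q = (2 ^ (m.choose 2 - m + 1)) ^ 2 *
          Module.finrank ℂ (cssCode (reedMuller (m - 3) m) (reedMuller (m - 3) m)) ∧
        IsQuantumCode Q (2 ^ m) (2 ^ (2 ^ m - 4 * m)) 6 ∧
        ¬ IsStabilizerCode Q ∧
        (m = 6 → IsQuantumCode Q 64 (2 ^ 40) 6) ∧
        (m = 8 → IsQuantumCode Q 256 (2 ^ 224) 6) ∧
        -- comparison with the enlarged Reed-Muller stabilizer codes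
        ∀ (D : Submodule (ZMod 2) ((Fin m → ZMod 2) → ZMod 2)) (A : D ≃ₗ[ZMod 2] D),
          IsEnlargementData (reedMuller (m - 3) m) (reedMuller (m - 2) m) D A →
          ∀ Q₁ : Submodule ℂ (Qubits (Fin m → ZMod 2)),
            Q₁ = enlargedCode (reedMuller (m - 3) m) D A →
            IsStabilizerCode Q₁ ∧
            Module.finrank ℂ Q₁ = 2 ^ (2 ^ m - m.choose 2 - 2 * m - 2) ∧
            (∀ w ∈ undetectedWeights Q₁, 6 ≤ w) ∧
            Module.finrank ℂ Q₁ < Module.finrank ℂ Q := by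
  have hn : Odd (m - 1) := Nat.Even.sub_odd (by omega) hm2 odd_one
  have hdual : dualCode (reedMuller (m - 3) m) = reedMuller 2 m := dualCode_reedMuller (by omega)
  have hC : dualCode (reedMuller (m - 3) m) ≤ reedMuller (m - 3) m :=
    hdual ▸ reedMuller_mono (by omega)
  -- dimensions
  have hbin : 3 * m ≤ m.choose 2 + m := by
    have h1 : m.choose 2 * 2 = m * (m - 1) := by
      rw [Nat.choose_two_right, Nat.div_mul_cancel (Nat.even_mul_pred_self m).two_dvd]
    obtain ⟨k, rfl⟩ : ∃ k, m = k + 6 := ⟨m - 6, by omega⟩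
    have h2 : k + 6 - 1 = k + 5 := rfl
    rw [h2] at h1
    nlinarith
  have hR3 := finrank_reedMuller_add (m := m) (r := m - 3) (k := 2) (by omega)
  have hR2 := finrank_reedMuller_add (m := m) (r := m - 2) (k := 1) (by omega)
  have hle : Module.finrank (ZMod 2) (reedMuller 2 m) ≤
      Module.finrank (ZMod 2) (reedMuller (m - 3) m) :=
    Submodule.finrank_mono (reedMuller_mono (by omega))
  rw [finrank_reedMuller_two] at hR3 hle
  rw [finrank_reedMuller_one] at hR2
  have hcss : Module.finrank ℂ (cssCode (reedMuller (m - 3) m) (reedMuller (m - 3) m)) =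
      2 ^ (2 ^ m - 2 * m.choose 2 - 2 * m - 2) := by
    have h1 := finrank_cssCode_mul hC
    rw [card_submodule_eq, card_submodule_eq, hdual, finrank_reedMuller_two] at h1
    have h2 : 0 < 2 ^ (1 + m + m.choose 2) := by positivity
    apply Nat.eq_of_mul_eq_mul_right h2
    rw [h1, ← pow_add]
    congr 1
    omega
  have hinv : ∀ c ∈ preparata e s, ∀ r ∈ reedMuller (m - 3) m, c + r ∈ preparata e s :=
    fun c hc r hr => add_mem_preparata (by omega) hc hr
  have hcard : ∀ T, IsCosetDecomposition (reedMuller (m - 3) m) T (preparata e s) →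
      T.card = 2 ^ (m.choose 2 - m + 1) := by
    intro T hT
    have h1 := hT.card_mul
    have h2 := ncard_preparata hF hn (by omega) hs e
    rw [← h1, card_submodule_eq, mul_assoc, ← pow_add] at h2
    have h3 : 2 * 2 ^ (m - 1) = 2 ^ m := by
      rw [← pow_succ']
      congr 1
      omega
    rw [h3] at h2
    apply Nat.eq_of_mul_eq_mul_right (Nat.pow_pos (n := Module.finrank (ZMod 2)
      (reedMuller (m - 3) m) + (2 * (m - 1) + 2)) (show 0 < 2 by norm_num))
    rw [h2, ← pow_add]
    congr 1
    omega
  have hP0 := zero_mem_preparata e s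
  have hPd : ∀ c ∈ preparata e s, ∀ c' ∈ preparata e s, c + c' ≠ 0 → 6 ≤ hammingNorm (c + c') :=
    fun c hc c' hc' => six_le_hammingNorm_add_of_mem_preparata hF hn hs hc hc'
  have hRd : ∀ c ∈ reedMuller (m - 3) m, c ≠ 0 → 8 ≤ hammingNorm c := fun c hc hc0 =>
    two_pow_le_hammingNorm_of_mem_reedMuller (r := 2) (by omega) hc hc0
  have hRd' : ∀ c ∈ reedMuller (m - 2) m, c ≠ 0 → 4 ≤ hammingNorm c := fun c hc hc0 =>
    two_pow_le_hammingNorm_of_mem_reedMuller (r := 1) (by omega) hc hc0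
  refine ⟨exists_isCosetDecomposition hinv, hcard, hC, ?_⟩
  rintro T₁ T₂ h₁ h₂ Q rfl
  have hdimQ : Module.finrank ℂ (cssUnionCode (reedMuller (m - 3) m) (reedMuller (m - 3) m) T₁ T₂) =
      (2 ^ (m.choose 2 - m + 1)) ^ 2 *
        Module.finrank ℂ (cssCode (reedMuller (m - 3) m) (reedMuller (m - 3) m)) := by
    rw [finrank_cssUnionCode h₁ h₂, hcard T₁ h₁, hcard T₂ h₂, sq]
  have hdimQ' : Module.finrank ℂ
      (cssUnionCode (reedMuller (m - 3) m) (reedMuller (m - 3) m) T₁ T₂) =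
      2 ^ (2 ^ m - 4 * m) := by
    rw [hdimQ, hcss, ← pow_mul, ← pow_add]
    congr 1
    omega
  have hcode : IsQuantumCode (cssUnionCode (reedMuller (m - 3) m) (reedMuller (m - 3) m) T₁ T₂)
      (2 ^ m) (2 ^ (2 ^ m - 4 * m)) 6 := by
    obtain ⟨c, hc, hc6⟩ := exists_mem_preparata_hammingNorm_eq_six hF hn (by omega) hs e
    refine ⟨by simp, hdimQ', isLeast_undetectedWeights_cssUnionCode hC h₁ h₂ hPd hP0 hc ?_ hc6⟩
    intro hcR
    have hc0 : c ≠ 0 := by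
      rintro rfl
      simp at hc6
    have := hRd c hcR hc0
    omega
  refine ⟨hdimQ, hcode, ?_, ?_, ?_, ?_⟩
  · obtain ⟨c, hc, c', hc', hcc'⟩ := exists_mem_preparata_add_notMem hF hn (by omega) hs e
    exact not_isStabilizerCode_cssUnionCode hC h₁ h₂ hP0 hc hc' hcc'
  · rintro rfl
    exact hcode
  · rintro rfl
    exact hcode
  · rintro D A hD Q₁ rfl
    have hdimQ₁ : Module.finrank ℂ (enlargedCode (reedMuller (m - 3) m) D A) =
        2 ^ (2 ^ m - m.choose 2 - 2 * m - 2) := by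
      -- D has dimension m choose 2, the difference of the dimensions of RM(m-2,m) and RM(m-3,m).
      have hfin := hD.finrank_add
      rw [finrank_enlargedCode hD, hcss, ← pow_add]
      congr 1
      omega
    refine ⟨isStabilizerCode_enlargedCode hC, hdimQ₁,
      six_le_of_mem_undetectedWeights_enlargedCode hD
        (fun c hc hc0 => le_trans (by norm_num) (hRd c hc hc0)) hRd', ?_⟩
    rw [hdimQ₁, hdimQ']
    -- The exponents differ by (m choose 2) - 2m + 2, which is positive.
    exact Nat.pow_lt_pow_right (by norm_num) (by omega)
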